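/- Let $\Omega\subset\mathbb R^n$ be a bounded connected open set with Lipschitz boundary (near each boundary point, $\Omega$ is, in suitable orthonormal coordinates, the set strictly above the graph of a Lipschitz function), and let $\Sigma\subset\overline\Omega$ be compact. For $x,y\in\overline\Omega$ let $\delta_\Omega(x,y)$ be the geodesic distance, i.e. the infimum of $\mathcal H^1(S)$ over Lipschitz curves $S\subset\overline\Omega$ joining $x$ to $y$, and let $\delta_\Omega(x,\Sigma)=\inf_{z\in\Sigma}\delta_\Omega(x,z)$ (equal to $+\infty$ if $\Sigma=\emptyset$). Let $c$ be the geodesic cost with free transport on $\Sigma$, $$c(x,y)=\min\{\delta_\Omega(x,y),\ \delta_\Omega(x,\Sigma)+\delta_\Omega(y,\Sigma)\}.$$ Let $\mu,\nu$ be Borel probability measures on $\overline\Omega$ and $$T_c(\mu,\nu)=\inf\Big\{\int_{\overline\Omega\times\overline\Omega}c\,d\gamma\ :\ \gamma \text{ is a measure on } \overline\Omega\times\overline\Omega \text{ with marginals } \mu,\nu\Big\}.$$ Then $$T_c(\mu,\nu)=\min\Big\{|\lambda|(\overline\Omega)\ :\ \lambda\in\mathcal M_b(\overline\Omega;\mathbb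 R^n),\ -\operatorname{div}\lambda=\mu-\nu\ \text{on}\ \overline\Omega\setminus\Sigma\Big\},$$ and the minimum is attained. Here $\mathcal M_b(\overline\Omega;\mathbb R^n)$ is the set of bounded $\mathbb R^n$-valued Borel measures on $\overline\Omega$, $|\lambda|$ is the total variation measure of $\lambda$ with respect to the Euclidean norm, and the divergence condition means that $\int_{\overline\Omega}\nabla\varphi\cdot d\lambda=\int_{\overline\Omega}\varphi\,d\mu-\int_{\overline\Omega}\varphi\,d\nu$ for all $\varphi\in C^\infty(\mathbb R^n)$ with compact support contained in $\mathbb R^n\setminus\Sigma$. The same formula, with the minimum attained, holds for the cost $$c(x,y)=\inf\{\mathcal H^1(S\setminus\Sigma)\ :\ S\subset\overline\Omega \text{ a Lipschitz curve joining } x \text{ to } y\},$$ provided that this cost vanishes on $\Sigma\times\Sigma$ (for instance if any two points of $\Sigma$ are joined by a Lipschitz curve contained in $\Sigma$). -/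

import Mathlib

open MeasureTheory Set Topology
open scoped ENNReal NNReal ContDiff

namespace GeodesicTransport

/-- `Ω` has a Lipschitz boundary: near each boundary point `p` there is a direction `e` such that
`Ω` is locally the set of points lying strictly above the graph, in the direction `e`, of a
Lipschitz function of the coordinates orthogonal to `e` (a function on the whole space which is
invariant under translations along `e`). -/
def HasLipschitzBoundary {n : ℕ} (Ω : Set (EuclideanSpace ℝ (Fin n))) : Prop :=
  ∀ p ∈ frontier Ω, ∃ e : EuclideanSpace ℝ (Fin n), ‖e‖ = 1 ∧
    ∃ (K : ℝ≥0) (g : EuclideanSpace ℝ (Fin n) → ℝ), LipschitzWith K g ∧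
      (∀ (x : EuclideanSpace ℝ (Fin n)) (t : ℝ), g (x + t • e) = g x) ∧
      ∃ U ∈ 𝓝 p, ∀ x ∈ U, (x ∈ Ω ↔ g x < inner ℝ e x)

/-- `γ : [0,1] → ℝⁿ` is a Lipschitz curve joining `x` to `y` inside `A`. -/
def IsLipschitzCurve {n : ℕ} (A : Set (EuclideanSpace ℝ (Fin n)))
    (x y : EuclideanSpace ℝ (Fin n)) (γ : unitInterval → EuclideanSpace ℝ (Fin n)) : Prop :=
  (∃ K : ℝ≥0, LipschitzWith K γ) ∧ γ 0 = x ∧ γ 1 = y ∧ range γ ⊆ A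

/-- The infimum of `ℋ¹(S \ Z)` over the Lipschitz curves `S` joining `x` to `y` in the closure
of `Ω`. -/
noncomputable def curveCost {n : ℕ} (Ω Z : Set (EuclideanSpace ℝ (Fin n)))
    (x y : EuclideanSpace ℝ (Fin n)) : ℝ≥0∞ :=
  ⨅ (γ : unitInterval → EuclideanSpace ℝ (Fin n)) (_ : IsLipschitzCurve (closure Ω) x y γ),
    Measure.hausdorffMeasure 1 (range γ \ Z)

/-- The geodesic distance on the closure of `Ω`: the infimum of the lengths `ℋ¹(S)` of the
Lipschitz curves `S` joining `x` to `y` in the closure of `Ω`. -/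
noncomputable def geodesicDist {n : ℕ} (Ω : Set (EuclideanSpace ℝ (Fin n)))
    (x y : EuclideanSpace ℝ (Fin n)) : ℝ≥0∞ :=
  curveCost Ω ∅ x y

/-- The geodesic distance to the set `Z` (equal to `∞` if `Z` is empty). -/
noncomputable def geodesicInfDist {n : ℕ} (Ω Z : Set (EuclideanSpace ℝ (Fin n)))
    (x : EuclideanSpace ℝ (Fin n)) : ℝ≥0∞ :=
  ⨅ z ∈ Z, geodesicDist Ω x z

/-- The geodesic cost with free transport on `Z`: either go directly from `x` to `y`, or go from
`x` to `Z`, move for free on `Z`, and go from `Z` to `y`. -/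
noncomputable def freeZoneCost {n : ℕ} (Ω Z : Set (EuclideanSpace ℝ (Fin n)))
    (x y : EuclideanSpace ℝ (Fin n)) : ℝ≥0∞ :=
  min (geodesicDist Ω x y) (geodesicInfDist Ω Z x + geodesicInfDist Ω Z y)

/-- The Monge–Kantorovich cost `T_c(μ, ν)`: the infimum of `∫ c dγ` over the transport plans `γ`,
the measures on the product with marginals `μ` and `ν`. -/
noncomputable def transportCost {X : Type*} [MeasurableSpace X] (c : X → X → ℝ≥0∞)
    (μ ν : Measure X) : ℝ≥0∞ :=
  ⨅ (γ : Measure (X × X)) (_ : γ.map Prod.fst = μ ∧ γ.map Prod.snd = ν),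
    ∫⁻ p, c p.1 p.2 ∂γ

/-- `-div Λ = μ - ν` on `closure Ω \ Z`: for every smooth `φ` with compact support in `ℝⁿ \ Z`,
the integral of `∇φ` against the vector measure `Λ` on `closure Ω` equals `∫ φ d(μ - ν)`. -/
def NegDivEq {n : ℕ} {Ω : Set (EuclideanSpace ℝ (Fin n))} (Z : Set (EuclideanSpace ℝ (Fin n)))
    (Λ : VectorMeasure (closure Ω) (EuclideanSpace ℝ (Fin n))) (μ ν : Measure (closure Ω)) :
    Prop :=
  ∀ φ : EuclideanSpace ℝ (Fin n) → ℝ, ContDiff ℝ ∞ φ → HasCompactSupport φ →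
    tsupport φ ⊆ Zᶜ →
      Λ.integral (fun x : closure Ω => gradient φ (x : EuclideanSpace ℝ (Fin n))) (innerSL ℝ) =
        (∫ x : closure Ω, φ x ∂μ) - ∫ x : closure Ω, φ x ∂ν

/-- The total masses `|Λ|(closure Ω)` of the bounded `ℝⁿ`-valued measures `Λ` on `closure Ω` with
`-div Λ = μ - ν` on `closure Ω \ Z`. -/
def flowMasses {n : ℕ} {Ω : Set (EuclideanSpace ℝ (Fin n))} (Z : Set (EuclideanSpace ℝ (Fin n)))
    (μ ν : Measure (closure Ω)) : Set ℝ≥0∞ :=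
  {m | ∃ Λ : VectorMeasure (closure Ω) (EuclideanSpace ℝ (Fin n)),
    Λ.variation univ < ⊤ ∧ NegDivEq Z Λ μ ν ∧ Λ.variation univ = m}

end GeodesicTransport

/-! A plan and a flow are both measures found by duality: a linear functional on continuous
functions that is nonnegative on the relevant cone is given by a measure. For transport plans the
dual problem maximizes `∫ u d(μ - ν)` over the functions `u` that are `1`-Lipschitz for the cost;
such a `u` is constant on `Z`. For flows it maximizes `∫ φ d(μ - ν)` over the test functions `φ`
with `|∇φ| ≤ 1` on `closure Ω`. A test function vanishes on `Z` and its oscillation is controlled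
along curves, so it is admissible for the first problem. Conversely, after subtracting the constant,
`u` is composed with an almost `1`-Lipschitz map pushing `closure Ω` into `Ω`, where `u` is locally
`1`-Lipschitz for the Euclidean distance, is made to vanish near `Z` by soft thresholding, and is
mollified; this gives test functions with `|∇φ| ≤ 1 + ε` that converge uniformly to `u`. -/

namespace GeodesicTransport

section Farkas

theorem exists_positive_linearMap_le {E M : Type*} [AddCommGroup E] [PartialOrder E]
    [IsOrderedAddMonoid E] [Module ℝ E] [PosSMulMono ℝ E] [AddCommGroup M] [Module ℝ M]
    (A : M →ₗ[ℝ] E) (b : M →ₗ[ℝ] ℝ) (P : PointedCone ℝ M)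
    (hb : ∀ m ∈ P, 0 ≤ A m → 0 ≤ b m) (hA : ∀ f, ∃ m ∈ P, f ≤ A m) :
    ∃ l : E →ₗ[ℝ] ℝ, (∀ f, 0 ≤ f → 0 ≤ l f) ∧ ∀ m ∈ P, l (A m) ≤ b m := by
  let C : PointedCone ℝ (E × ℝ) := P.map ((-A).prod b) ⊔ PointedCone.positive ℝ (E × ℝ)
  let second : (E × ℝ) →ₗ.[ℝ] ℝ :=
    { domain := (⊥ : Submodule ℝ E).prod ⊤
      toFun := (LinearMap.snd ℝ E ℝ).comp (Submodule.subtype _) }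
  have second_nonneg : ∀ p : second.domain, (p : E × ℝ) ∈ C → 0 ≤ second p := by
    rintro ⟨⟨f, t⟩, hdom⟩ hp
    have hf : f = 0 := hdom.1
    obtain ⟨_, ⟨m, hm, rfl⟩, ⟨g, s⟩, ⟨hg, hs⟩, h⟩ := Submodule.mem_sup.1 hp
    obtain ⟨hg', rfl⟩ : -A m + g = f ∧ b m + s = t := by simpa using h
    have : A m = g := by rw [hf] at hg'; simpa using (eq_neg_of_add_eq_zero_right hg').symm
    exact add_nonneg (hb m hm (this ▸ hg)) hs
  have dense : ∀ y, ∃ p : second.domain, (p : E × ℝ) + y ∈ C := by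
    rintro ⟨f, t⟩
    obtain ⟨m, hm, hfm⟩ := hA (-f)
    refine ⟨⟨(0, b m - t), by simp [second]⟩, Submodule.mem_sup.2
      ⟨(-A m, b m), ⟨m, hm, rfl⟩, (A m + f, 0), ⟨neg_le_iff_add_nonneg.1 hfm, le_rfl⟩, ?_⟩⟩
    simp
  obtain ⟨F, hF, hFC⟩ := riesz_extension C second second_nonneg dense
  have hF_snd (t : ℝ) : F (0, t) = t := hF ⟨(0, t), by simp [second]⟩
  refine ⟨F.comp (LinearMap.inl ℝ E ℝ), fun f hf => hFC _ (Submodule.mem_sup_right ⟨hf, le_rfl⟩),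
    fun m hm => ?_⟩
  have h : 0 ≤ F (-A m, b m) := hFC _ (Submodule.mem_sup_left ⟨m, hm, rfl⟩)
  have h_split : (-A m, b m) = -(A m, (0 : ℝ)) + (0, b m) := by simp
  rw [h_split, map_add, map_neg, hF_snd] at h
  simpa using h

variable {X : Type*} [TopologicalSpace X] [T2Space X] [CompactSpace X] [MeasurableSpace X]
  [BorelSpace X]

theorem exists_measure_of_positive (l : C(X, ℝ) →ₗ[ℝ] ℝ) (hl : ∀ f, 0 ≤ f → 0 ≤ l f) :
    ∃ m : Measure X, IsFiniteMeasure m ∧ ∀ f : C(X, ℝ), ∫ x, f x ∂m = l f := by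
  let L : CompactlySupportedContinuousMap X ℝ →ₗ[ℝ] ℝ :=
    { toFun := fun f => l f.toContinuousMap
      map_add' := fun f g => l.map_add f.toContinuousMap g.toContinuousMap
      map_smul' := fun a f => l.map_smul a f.toContinuousMap }
  let Λ := PositiveLinearMap.mk₀ L fun f hf => hl f.toContinuousMap hf
  exact ⟨RealRMK.rieszMeasure Λ, inferInstance, fun f =>
    RealRMK.integral_rieszMeasure Λ (CompactlySupportedContinuousMap.continuousMapEquiv f)⟩

theorem exists_measure_integral_le {M : Type*} [AddCommGroup M] [Module ℝ M]
    (A : M →ₗ[ℝ] C(X, ℝ)) (b : M →ₗ[ℝ] ℝ) (P : PointedCone ℝ M)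
    (hb : ∀ m ∈ P, 0 ≤ A m → 0 ≤ b m) (h_one : ∃ m ∈ P, A m = 1) :
    ∃ γ : Measure X, IsFiniteMeasure γ ∧ ∀ m ∈ P, ∫ x, A m x ∂γ ≤ b m := by
  obtain ⟨m₁, hm₁, hA⟩ := h_one
  obtain ⟨l, hl, hlb⟩ := exists_positive_linearMap_le A b P hb fun f => by
    refine ⟨‖f‖ • m₁, P.smul_mem (norm_nonneg f) hm₁, fun x => ?_⟩
    simpa [hA] using (le_abs_self _).trans (f.norm_coe_le_norm x)
  obtain ⟨γ, hγ, hγl⟩ := exists_measure_of_positive l hl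
  exact ⟨γ, hγ, fun m hm => (hγl _).trans_le (hlb m hm)⟩

end Farkas

section Kantorovich

section ContinuousCost

variable {X Y : Type*} [TopologicalSpace X] [CompactSpace X] [MeasurableSpace X]
  [OpensMeasurableSpace X] [TopologicalSpace Y] [CompactSpace Y] [MeasurableSpace Y]
  [OpensMeasurableSpace Y]

theorem integrable_of_continuous {m : Measure X} [IsFiniteMeasure m] {f : X → ℝ}
    (hf : Continuous f) : Integrable f m :=
  BoundedContinuousFunction.integrable m (BoundedContinuousFunction.mkOfCompact ⟨f, hf⟩)

/-- Integration of continuous functions on a compact space against a finite measure. -/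
noncomputable def integralₗ (m : Measure X) [IsFiniteMeasure m] : C(X, ℝ) →ₗ[ℝ] ℝ where
  toFun f := ∫ x, f x ∂m
  map_add' f g := integral_add (integrable_of_continuous f.continuous)
    (integrable_of_continuous g.continuous)
  map_smul' a f := integral_const_mul a f

theorem integral_add_integral_nonneg {μ : Measure X} {ν : Measure Y} [IsProbabilityMeasure μ]
    [IsProbabilityMeasure ν] {φ : C(X, ℝ)} {ψ : C(Y, ℝ)} (h : ∀ x y, 0 ≤ φ x + ψ y) :
    0 ≤ ∫ x, φ x ∂μ + ∫ y, ψ y ∂ν := by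
  have hφ (y : Y) : 0 ≤ ∫ x, φ x ∂μ + ψ y := by
    have : 0 ≤ ∫ x, (φ x + ψ y) ∂μ := integral_nonneg fun x => h x y
    simpa [integral_add (integrable_of_continuous φ.continuous) (integrable_const (ψ y))] using this
  have : 0 ≤ ∫ y, (∫ x, φ x ∂μ + ψ y) ∂ν := integral_nonneg hφ
  simpa [integral_add (integrable_const _) (integrable_of_continuous ψ.continuous)] using this

/-- The function `φ(x) + ψ(y) + t c(x, y)`, the left-hand side of a constraint
on transport plans. -/
noncomputable def planConstraint (c : C(X × Y, ℝ)) : C(X, ℝ) × C(Y, ℝ) × ℝ →ₗ[ℝ] C(X × Y, ℝ) where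
  toFun m := m.1.comp .fst + m.2.1.comp .snd + m.2.2 • c
  map_add' m m' := by
    ext p
    simp only [Prod.fst_add, Prod.snd_add, ContinuousMap.add_apply, ContinuousMap.smul_apply,
      ContinuousMap.comp_apply, smul_eq_mul]
    ring
  map_smul' a m := by
    ext p
    simp [mul_assoc]

/-- The value `∫ φ dμ + ∫ ψ dν + t D`, the right-hand side of a constraint on transport plans
of cost at most `D`. -/
noncomputable def planBound (μ : Measure X) (ν : Measure Y) [IsFiniteMeasure μ] [IsFiniteMeasure ν]
    (D : ℝ) : C(X, ℝ) × C(Y, ℝ) × ℝ →ₗ[ℝ] ℝ :=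
  (integralₗ μ).coprod ((integralₗ ν).coprod (LinearMap.mulRight ℝ D))

theorem planBound_nonneg {μ : Measure X} {ν : Measure Y} [IsProbabilityMeasure μ]
    [IsProbabilityMeasure ν] {c : C(X × Y, ℝ)} {D : ℝ}
    (hD : ∀ (φ : C(X, ℝ)) (ψ : C(Y, ℝ)), (∀ x y, φ x + ψ y ≤ c (x, y)) →
      ∫ x, φ x ∂μ + ∫ y, ψ y ∂ν ≤ D)
    {φ : C(X, ℝ)} {ψ : C(Y, ℝ)} {t : ℝ} (ht : 0 ≤ t) (h : 0 ≤ planConstraint c (φ, ψ, t)) :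
    0 ≤ planBound μ ν D (φ, ψ, t) := by
  have hpt (x : X) (y : Y) : 0 ≤ φ x + ψ y + t * c (x, y) := h (x, y)
  change 0 ≤ ∫ x, φ x ∂μ + (∫ y, ψ y ∂ν + t * D)
  rcases ht.eq_or_lt with rfl | ht
  · simpa using integral_add_integral_nonneg (μ := μ) (ν := ν) (by simpa using hpt)
  · have hdual := hD ((-t⁻¹) • φ) ((-t⁻¹) • ψ) fun x y => by
      have : 0 ≤ t⁻¹ * (φ x + ψ y + t * c (x, y)) := mul_nonneg (inv_nonneg.2 ht.le) (hpt x y)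
      rw [mul_add, inv_mul_cancel_left₀ ht.ne'] at this
      simp only [ContinuousMap.smul_apply, smul_eq_mul]
      linarith
    simp only [ContinuousMap.smul_apply, smul_eq_mul, integral_const_mul, ← mul_add] at hdual
    rw [neg_mul, ← mul_neg, inv_mul_le_iff₀ ht] at hdual
    linarith

end ContinuousCost

theorem exists_plan_of_dual_le {X Y : Type*} [MetricSpace X] [CompactSpace X] [MeasurableSpace X]
    [BorelSpace X] [MetricSpace Y] [CompactSpace Y] [MeasurableSpace Y] [BorelSpace Y]
    {μ : Measure X} {ν : Measure Y} [IsProbabilityMeasure μ] [IsProbabilityMeasure ν]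
    {c : C(X × Y, ℝ)} {D : ℝ}
    (hD : ∀ (φ : C(X, ℝ)) (ψ : C(Y, ℝ)), (∀ x y, φ x + ψ y ≤ c (x, y)) →
      ∫ x, φ x ∂μ + ∫ y, ψ y ∂ν ≤ D) :
    ∃ γ : Measure (X × Y), IsFiniteMeasure γ ∧ γ.map Prod.fst = μ ∧ γ.map Prod.snd = ν ∧
      ∫ p, c p ∂γ ≤ D := by
  obtain ⟨γ, hγ, hγ_le⟩ := exists_measure_integral_le (planConstraint c) (planBound μ ν D)
    ((PointedCone.positive ℝ ℝ).comap ((LinearMap.snd ℝ _ ℝ).comp (LinearMap.snd ℝ _ _)))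
    (fun m hm h => planBound_nonneg hD hm h)
    ⟨(1, 0, 0), le_refl (0 : ℝ), by ext p; simp [planConstraint]⟩
  have le_bound (φ : C(X, ℝ)) (ψ : C(Y, ℝ)) (t : ℝ) (ht : 0 ≤ t) :
      ∫ p, (φ p.1 + ψ p.2 + t * c p) ∂γ ≤ ∫ x, φ x ∂μ + (∫ y, ψ y ∂ν + t * D) :=
    hγ_le (φ, ψ, t) ht
  have marginals (φ : C(X, ℝ)) (ψ : C(Y, ℝ)) :
      ∫ p, (φ p.1 + ψ p.2) ∂γ = ∫ x, φ x ∂μ + ∫ y, ψ y ∂ν := by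
    refine le_antisymm (by simpa using le_bound φ ψ 0 le_rfl) ?_
    have := le_bound (-φ) (-ψ) 0 le_rfl
    simp only [ContinuousMap.neg_apply, ← neg_add, integral_neg, zero_mul, add_zero] at this
    linarith
  refine ⟨γ, hγ, ?_, ?_, by simpa using le_bound 0 0 1 zero_le_one⟩
  · refine ext_of_forall_integral_eq_of_IsFiniteMeasure fun f => ?_
    rw [integral_map measurable_fst.aemeasurable f.continuous.aestronglyMeasurable]
    simpa using marginals f.toContinuousMap 0
  · refine ext_of_forall_integral_eq_of_IsFiniteMeasure fun f => ?_
    rw [integral_map measurable_snd.aemeasurable f.continuous.aestronglyMeasurable]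
    simpa using marginals 0 f.toContinuousMap

theorem continuous_of_sub_le {X : Type*} [TopologicalSpace X] {c : X → X → ℝ}
    (hc : Continuous fun p : X × X => c p.1 p.2) (hc_self : ∀ x, c x x = 0) {u : X → ℝ}
    (hu : ∀ x y, u x - u y ≤ c x y) : Continuous u := by
  refine continuous_iff_continuousAt.2 fun x => tendsto_iff_dist_tendsto_zero.2 ?_
  have h_symm : Continuous fun y => max (c x y) (c y x) :=
    (hc.comp (Continuous.prodMk_right x)).max (hc.comp (Continuous.prodMk_left x))
  refine squeeze_zero (fun _ => dist_nonneg) (fun y => ?_)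
    ((h_symm.tendsto' x 0) (by simp [hc_self]))
  rw [Real.dist_eq, abs_le']
  exact ⟨(hu y x).trans (le_max_right _ _),
    (neg_sub (u y) (u x)).trans_le ((hu x y).trans (le_max_left _ _))⟩

theorem exists_continuousMap_between_conjugates {X : Type*} [TopologicalSpace X] [Nonempty X]
    {c : X → X → ℝ} (hc : Continuous fun p : X × X => c p.1 p.2) (hc_self : ∀ x, c x x = 0)
    (hc_tri : ∀ x y z, c x z ≤ c x y + c y z) {φ ψ : X → ℝ} (h : ∀ x y, φ x + ψ y ≤ c x y) :
    ∃ u : C(X, ℝ), (∀ x y, u x - u y ≤ c x y) ∧ (∀ x, φ x ≤ u x) ∧ ∀ x, u x ≤ -ψ x := by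
  have h' (x y : X) : φ x ≤ c x y - ψ y := le_sub_iff_add_le.2 (h x y)
  have hbdd (x : X) : BddBelow (range fun y => c x y - ψ y) := ⟨φ x, forall_mem_range.2 (h' x)⟩
  let u : X → ℝ := fun x => ⨅ y, (c x y - ψ y)
  have hu (x y : X) : u x - u y ≤ c x y := by
    refine sub_le_comm.1 (le_ciInf fun z => ?_)
    have : u x ≤ c x z - ψ z := ciInf_le (hbdd x) z
    linarith [hc_tri x y z]
  refine ⟨⟨u, continuous_of_sub_le hc hc_self hu⟩, hu, fun x => le_ciInf (h' x), fun x => ?_⟩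
  simpa [hc_self] using ciInf_le (hbdd x) x

section Rubinstein

variable {X : Type*} [MeasurableSpace X] {c : X → X → ℝ≥0∞} {μ ν : Measure X}

theorem transportCost_le_lintegral {γ : Measure (X × X)} (hμ : γ.map Prod.fst = μ)
    (hν : γ.map Prod.snd = ν) : transportCost c μ ν ≤ ∫⁻ p, c p.1 p.2 ∂γ :=
  iInf₂_le γ ⟨hμ, hν⟩

theorem transportCost_le_of_forall_sub_le [MetricSpace X] [CompactSpace X] [BorelSpace X]
    [IsProbabilityMeasure μ] [IsProbabilityMeasure ν] (hc_fin : ∀ x y, c x y ≠ ⊤)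
    (hc : Continuous fun p : X × X => c p.1 p.2) (hc_self : ∀ x, c x x = 0)
    (hc_tri : ∀ x y z, c x z ≤ c x y + c y z) {D : ℝ}
    (hD : ∀ u : C(X, ℝ), (∀ x y, u x - u y ≤ (c x y).toReal) → ∫ x, u x ∂μ - ∫ x, u x ∂ν ≤ D) :
    transportCost c μ ν ≤ ENNReal.ofReal D := by
  have hX : Nonempty X := nonempty_of_isProbabilityMeasure μ
  have hc_real : Continuous fun p : X × X => (c p.1 p.2).toReal :=
    ENNReal.continuousOn_toReal.comp_continuous hc fun p => hc_fin p.1 p.2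
  have hc_real_tri (x y z : X) : (c x z).toReal ≤ (c x y).toReal + (c y z).toReal := by
    rw [← ENNReal.toReal_add (hc_fin x y) (hc_fin y z)]
    exact ENNReal.toReal_mono (ENNReal.add_ne_top.2 ⟨hc_fin x y, hc_fin y z⟩) (hc_tri x y z)
  obtain ⟨γ, hγ, hγ_fst, hγ_snd, hγD⟩ := exists_plan_of_dual_le (μ := μ) (ν := ν)
    (c := ⟨_, hc_real⟩) (D := D) fun φ ψ h => by
      obtain ⟨u, hu, hφ, hψ⟩ := exists_continuousMap_between_conjugates hc_real
        (fun x => by simp [hc_self]) hc_real_tri h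
      have hint (m : Measure X) [IsProbabilityMeasure m] (f : C(X, ℝ)) : Integrable f m :=
        integrable_of_continuous f.continuous
      have h₁ : ∫ x, φ x ∂μ ≤ ∫ x, u x ∂μ := integral_mono (hint μ φ) (hint μ u) hφ
      have h₂ : ∫ x, u x ∂ν ≤ ∫ x, -ψ x ∂ν := integral_mono (hint ν u) (hint ν ψ).neg hψ
      rw [integral_neg] at h₂
      linarith [hD u hu]
  refine (transportCost_le_lintegral hγ_fst hγ_snd).trans ?_
  rw [← lintegral_congr fun p : X × X => ENNReal.ofReal_toReal (hc_fin p.1 p.2),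
    ← ofReal_integral_eq_lintegral_ofReal (integrable_of_continuous hc_real)
      (ae_of_all _ fun p => ENNReal.toReal_nonneg)]
  exact ENNReal.ofReal_le_ofReal hγD

theorem ofReal_integral_sub_le_mul_transportCost {u : X → ℝ} (hu_meas : Measurable u)
    (hμ : Integrable u μ) (hν : Integrable u ν) {K : ℝ≥0} (hK : K ≠ 0)
    (hu : ∀ x y, edist (u x) (u y) ≤ K * c x y) :
    ENNReal.ofReal (∫ x, u x ∂μ - ∫ x, u x ∂ν) ≤ K * transportCost c μ ν := by
  simp only [transportCost, ENNReal.mul_iInf_of_ne (ENNReal.coe_ne_zero.2 hK) ENNReal.coe_ne_top]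
  refine le_iInf₂ fun γ ⟨hγ_fst, hγ_snd⟩ => ?_
  subst hγ_fst hγ_snd
  rw [integral_map measurable_fst.aemeasurable hu_meas.aestronglyMeasurable,
    integral_map measurable_snd.aemeasurable hu_meas.aestronglyMeasurable,
    ← integral_sub (f := fun p : X × X => u p.1) (g := fun p => u p.2)
      (hμ.comp_measurable measurable_fst) (hν.comp_measurable measurable_snd)]
  calc ENNReal.ofReal (∫ p, (u p.1 - u p.2) ∂γ)
      ≤ ENNReal.ofReal ‖∫ p, (u p.1 - u p.2) ∂γ‖ := ENNReal.ofReal_le_ofReal (le_abs_self _)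
    _ ≤ ∫⁻ p, edist (u p.1) (u p.2) ∂γ := by
      simpa only [ofReal_norm, edist_eq_enorm_sub] using enorm_integral_le_lintegral_enorm _
    _ ≤ ∫⁻ p, K * c p.1 p.2 ∂γ := lintegral_mono fun p => hu p.1 p.2
    _ = K * ∫⁻ p, c p.1 p.2 ∂γ := lintegral_const_mul' _ _ ENNReal.coe_ne_top

end Rubinstein

end Kantorovich

section WithDensity

variable {X V W G : Type*} [NormedAddCommGroup V] [NormedSpace ℝ V] [NormedAddCommGroup W]
  [NormedSpace ℝ W] [NormedAddCommGroup G] [NormedSpace ℝ G]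

theorem norm_bilin_le (B : V →L[ℝ] W →L[ℝ] G) {v : V} {C : ℝ} (hv : ‖v‖ ≤ C) (w : W) :
    ‖B v w‖ ≤ ‖B‖ * C * ‖w‖ :=
  (B.le_opNorm₂ v w).trans (by gcongr)

variable [MeasurableSpace X] {m : Measure X} {w : X → W}

theorem integrable_bilin_of_norm_le (hw : Integrable w m) (B : V →L[ℝ] W →L[ℝ] G) {v : X → V}
    (hv : StronglyMeasurable v) {C : ℝ} (hC : ∀ x, ‖v x‖ ≤ C) :
    Integrable (fun x => B (v x) (w x)) m :=
  (hw.norm.const_mul (‖B‖ * C)).mono'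
    (B.aestronglyMeasurable_comp₂ hv.aestronglyMeasurable hw.aestronglyMeasurable)
    (ae_of_all _ fun x => norm_bilin_le B (hC x) (w x))

variable [CompleteSpace W]

theorem variation_withDensityᵥ_univ (hw : Integrable w m) :
    (m.withDensityᵥ w).variation univ = ∫⁻ x, ‖w x‖ₑ ∂m := by
  rw [Measure.variation_withDensityᵥ hw, withDensity_apply _ MeasurableSet.univ,
    Measure.restrict_univ]

theorem isFiniteMeasure_variation_withDensityᵥ (hw : Integrable w m) :
    IsFiniteMeasure (m.withDensityᵥ w).variation :=
  ⟨(variation_withDensityᵥ_univ hw).trans_lt hw.hasFiniteIntegral⟩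

variable [CompleteSpace G]

theorem integral_withDensityᵥ_simpleFunc (hw : Integrable w m) (B : V →L[ℝ] W →L[ℝ] G)
    (v : SimpleFunc X V) : (m.withDensityᵥ w).integral v B = ∫ x, B (v x) (w x) ∂m := by
  have := isFiniteMeasure_variation_withDensityᵥ hw
  have hint (f : SimpleFunc X V) : Integrable (fun x => B (f x) (w x)) m :=
    let ⟨_, hC⟩ := f.exists_forall_norm_le
    integrable_bilin_of_norm_le hw B f.stronglyMeasurable hC
  induction v using SimpleFunc.induction with
  | @const a s hs =>
    have h_const : (m.withDensityᵥ w).integral (s.indicator fun _ => a) B =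
        B a (m.withDensityᵥ w s) :=
      setToFun_indicator_const _ hs (measure_ne_top _ _) a
    rw [withDensityᵥ_apply hw hs, ← ContinuousLinearMap.integral_comp_comm _ hw.restrict,
      ← integral_indicator hs] at h_const
    simp only [SimpleFunc.coe_piecewise, SimpleFunc.coe_const, Function.const_zero,
      piecewise_eq_indicator]
    refine h_const.trans (integral_congr_ae (ae_of_all _ fun x => ?_))
    by_cases hx : x ∈ s <;> simp [hx, Function.const]
  | @add f g _ hf hg =>
    rw [SimpleFunc.coe_add, VectorMeasure.integral_add f.integrable_of_isFiniteMeasure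
      g.integrable_of_isFiniteMeasure, hf, hg, ← integral_add (hint f) (hint g)]
    simp

theorem integral_withDensityᵥ (hw : Integrable w m) (B : V →L[ℝ] W →L[ℝ] G) {v : X → V}
    (hv : StronglyMeasurable v) {C : ℝ} (hC : ∀ x, ‖v x‖ ≤ C) :
    (m.withDensityᵥ w).integral v B = ∫ x, B (v x) (w x) ∂m := by
  have := isFiniteMeasure_variation_withDensityᵥ hw
  rcases isEmpty_or_nonempty X with hX | ⟨⟨x₀⟩⟩
  · rw [VectorMeasure.integral_of_isEmpty, integral_of_isEmpty]
  have hlim (x : X) : Filter.Tendsto (hv.approxBounded C · x) Filter.atTop (𝓝 (v x)) :=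
    hv.tendsto_approxBounded_of_norm_le (hC x)
  have hnorm (k : ℕ) (x : X) : ‖hv.approxBounded C k x‖ ≤ C :=
    hv.norm_approxBounded_le ((norm_nonneg _).trans (hC x₀)) k x
  have lim_left : Filter.Tendsto (fun k => (m.withDensityᵥ w).integral (hv.approxBounded C k) B)
      Filter.atTop (𝓝 ((m.withDensityᵥ w).integral v B)) :=
    VectorMeasure.tendsto_integral_filter_of_norm_le_const
      (.of_forall fun k => (SimpleFunc.stronglyMeasurable _).aestronglyMeasurable)
      ⟨C, .of_forall fun k => ae_of_all _ (hnorm k)⟩ (ae_of_all _ hlim)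
  have lim_right : Filter.Tendsto (fun k => ∫ x, B (hv.approxBounded C k x) (w x) ∂m)
      Filter.atTop (𝓝 (∫ x, B (v x) (w x) ∂m)) :=
    tendsto_integral_of_dominated_convergence (fun x => ‖B‖ * C * ‖w x‖)
      (fun k => (integrable_bilin_of_norm_le hw B (SimpleFunc.stronglyMeasurable _)
        (hnorm k)).aestronglyMeasurable) (hw.norm.const_mul _)
      (fun k => ae_of_all _ fun x => norm_bilin_le B (hnorm k x) (w x))
      (ae_of_all _ fun x => ((B.flip (w x)).continuous.tendsto _).comp (hlim x))
  simp only [integral_withDensityᵥ_simpleFunc hw] at lim_left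
  exact tendsto_nhds_unique lim_left lim_right

end WithDensity

section FlowDuality

theorem norm_le_of_forall_inner_add_nonneg {E : Type*} [NormedAddCommGroup E]
    [InnerProductSpace ℝ E] {v : E} {s : ℝ} (h : ∀ e : E, ‖e‖ ≤ 1 → 0 ≤ inner ℝ v e + s) :
    ‖v‖ ≤ s := by
  have hv := h (-(‖v‖⁻¹ • v)) (by simpa [norm_smul] using inv_mul_le_one)
  rwa [inner_neg_right, inner_smul_right, real_inner_self_eq_norm_sq, pow_two,
    ← mul_assoc, inv_mul_mul_self, neg_add_eq_sub, sub_nonneg] at hv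

variable {X E F : Type*} [MetricSpace X] [CompactSpace X]
  [NormedAddCommGroup E] [InnerProductSpace ℝ E] [AddCommGroup F] [Module ℝ F]

/-- The function `⟪D φ x, e⟫ + s` on the product of `X` with the unit ball, the left-hand side
of a constraint on the measures that lift a flow to the space of positions and directions. -/
noncomputable def flowConstraint (D : F →ₗ[ℝ] C(X, E)) :
    F × ℝ →ₗ[ℝ] C(X × Metric.closedBall (0 : E) 1, ℝ) where
  toFun m := ⟨fun p => inner ℝ (D m.1 p.1) (p.2 : E) + m.2, by fun_prop⟩
  map_add' m m' := by
    ext p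
    simp only [Prod.fst_add, Prod.snd_add, map_add, ContinuousMap.add_apply, inner_add_left,
      ContinuousMap.coe_mk]
    ring
  map_smul' a m := by
    ext p
    simp [inner_smul_left, mul_add]

variable [MeasurableSpace X] [BorelSpace X] [FiniteDimensional ℝ E]

theorem exists_lift_of_dual_le [Nonempty X] [MeasurableSpace E] [BorelSpace E]
    {D : F →ₗ[ℝ] C(X, E)} {L : F →ₗ[ℝ] ℝ} {T : ℝ≥0} (hL : ∀ φ, L φ ≤ T * ‖D φ‖) :
    ∃ m : Measure (X × Metric.closedBall (0 : E) 1), m univ ≤ T ∧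
      ∀ φ, ∫ p, inner ℝ (D φ p.1) (p.2 : E) ∂m = L φ := by
  have : CompactSpace (Metric.closedBall (0 : E) 1) :=
    isCompact_iff_compactSpace.1 (isCompact_closedBall 0 1)
  obtain ⟨m, hm, hm_le⟩ := exists_measure_integral_le (flowConstraint D)
    (L.coprod (LinearMap.mulRight ℝ (T : ℝ))) ⊤ (fun ⟨φ, s⟩ _ h => by
      have hD (x : X) : ‖D φ x‖ ≤ s := norm_le_of_forall_inner_add_nonneg fun e he =>
        h (x, ⟨e, mem_closedBall_zero_iff.2 he⟩)
      have hDs : ‖D φ‖ ≤ s := (ContinuousMap.norm_le_of_nonempty _).2 hD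
      have hφ : -L φ ≤ T * s := calc
        -L φ ≤ T * ‖D φ‖ := by simpa using hL (-φ)
        _ ≤ T * s := by gcongr
      change 0 ≤ L φ + s * T
      linarith) ⟨(0, 1), trivial, by ext p; simp [flowConstraint]⟩
  have le_bound (φ : F) (s : ℝ) :
      ∫ p, (inner ℝ (D φ p.1) (p.2 : E) + s) ∂m ≤ L φ + s * T := hm_le (φ, s) trivial
  refine ⟨m, ?_, fun φ => le_antisymm (by simpa using le_bound φ 0) ?_⟩
  · rw [← ENNReal.ofReal_coe_nnreal, ENNReal.le_ofReal_iff_toReal_le (measure_ne_top _ _)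
      T.coe_nonneg]
    simpa [Measure.real] using le_bound 0 1
  · have := le_bound (-φ) 0
    simp only [map_neg, ContinuousMap.neg_apply, inner_neg_left, add_zero, zero_mul,
      integral_neg] at this
    linarith

theorem exists_vectorMeasure_of_dual_le [Nonempty X] {D : F →ₗ[ℝ] C(X, E)} {L : F →ₗ[ℝ] ℝ}
    {T : ℝ≥0} (hL : ∀ φ, L φ ≤ T * ‖D φ‖) :
    ∃ Λ : VectorMeasure X E, Λ.variation univ ≤ T ∧ ∀ φ, Λ.integral (D φ) (innerSL ℝ) = L φ := by
  borelize E
  obtain ⟨m, hm_mass, hm⟩ := exists_lift_of_dual_le hL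
  have : IsFiniteMeasure m := ⟨hm_mass.trans_lt ENNReal.coe_lt_top⟩
  let w : X × Metric.closedBall (0 : E) 1 → E := fun p => p.2
  have hw_norm (p : X × Metric.closedBall (0 : E) 1) : ‖w p‖ ≤ 1 :=
    mem_closedBall_zero_iff.1 p.2.2
  have hw : Integrable w m :=
    (integrable_const (1 : ℝ)).mono' (by fun_prop) (ae_of_all _ hw_norm)
  have := isFiniteMeasure_variation_withDensityᵥ hw
  refine ⟨(m.withDensityᵥ w).map Prod.fst, ?_, fun φ => ?_⟩
  · calc ((m.withDensityᵥ w).map Prod.fst).variation univ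
        ≤ (m.withDensityᵥ w).variation.map Prod.fst univ := VectorMeasure.variation_map_le univ
      _ = ∫⁻ p, ‖w p‖ₑ ∂m := by
        rw [Measure.map_apply measurable_fst .univ, preimage_univ, variation_withDensityᵥ_univ hw]
      _ ≤ ∫⁻ _, 1 ∂m := lintegral_mono fun p => by
        exact (enorm_le_coe (r := 1)).2 (hw_norm p)
      _ ≤ T := by simpa using hm_mass
  · have hD_meas : StronglyMeasurable fun p : X × Metric.closedBall (0 : E) 1 => D φ p.1 :=
      ((D φ).continuous.comp continuous_fst).stronglyMeasurable
    have hD_norm (p : X × Metric.closedBall (0 : E) 1) : ‖D φ p.1‖ ≤ ‖D φ‖ :=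
      (D φ).norm_coe_le_norm p.1
    rw [VectorMeasure.integral_map measurable_fst (D φ).continuous.aestronglyMeasurable
        ((integrable_const ‖D φ‖).mono' hD_meas.aestronglyMeasurable (ae_of_all _ hD_norm)),
      integral_withDensityᵥ hw _ hD_meas hD_norm]
    exact hm φ

end FlowDuality

section Curves

variable {n : ℕ} {A B Ω Z : Set (EuclideanSpace ℝ (Fin n))} {x y z : EuclideanSpace ℝ (Fin n)}
  {γ : unitInterval → EuclideanSpace ℝ (Fin n)}

/-- `x` and `y` are joined by a Lipschitz curve contained in `A`. The cost of a curve only depends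
on its image, so this relation is all that has to be known about curves. -/
def LipschitzJoined (A : Set (EuclideanSpace ℝ (Fin n))) (x y : EuclideanSpace ℝ (Fin n)) : Prop :=
  ∃ γ, IsLipschitzCurve A x y γ

theorem IsLipschitzCurve.joined_range (hγ : IsLipschitzCurve A x y γ) :
    LipschitzJoined (range γ) x y :=
  ⟨γ, hγ.1, hγ.2.1, hγ.2.2.1, subset_rfl⟩

theorem IsLipschitzCurve.continuous (hγ : IsLipschitzCurve A x y γ) : Continuous γ :=
  let ⟨_, hK⟩ := hγ.1
  hK.continuous

theorem LipschitzJoined.mono (h : LipschitzJoined A x y) (hAB : A ⊆ B) : LipschitzJoined B x y :=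
  let ⟨γ, hlip, h0, h1, hA⟩ := h
  ⟨γ, hlip, h0, h1, hA.trans hAB⟩

theorem LipschitzJoined.symm (h : LipschitzJoined A x y) : LipschitzJoined A y x := by
  obtain ⟨γ, ⟨K, hK⟩, h0, h1, hA⟩ := h
  refine ⟨γ ∘ unitInterval.symm, ⟨K, LipschitzWith.of_dist_le_mul fun s t => ?_⟩, by simp [h1],
    by simp [h0], (range_comp_subset_range _ _).trans hA⟩
  refine (hK.dist_le_mul _ _).trans_eq ?_
  rw [Subtype.dist_eq, Subtype.dist_eq, unitInterval.coe_symm_eq, unitInterval.coe_symm_eq,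
    dist_sub_left]

/-- Concatenation is the sum of two curves that rest outside their half of the interval. -/
theorem LipschitzJoined.trans (hxy : LipschitzJoined A x y) (hyz : LipschitzJoined B y z) :
    LipschitzJoined (A ∪ B) x z := by
  obtain ⟨γ₁, ⟨K₁, hK₁⟩, hx, hy, hA⟩ := hxy
  obtain ⟨γ₂, ⟨K₂, hK₂⟩, hy', hz, hB⟩ := hyz
  let left (θ : unitInterval) : unitInterval := projIcc 0 1 zero_le_one (2 * (θ : ℝ))
  let right (θ : unitInterval) : unitInterval := projIcc 0 1 zero_le_one (2 * (θ : ℝ) - 1)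
  have h_double : LipschitzWith 2 fun θ : unitInterval => 2 * (θ : ℝ) :=
    .of_dist_le_mul fun s t => by
      simp [Real.dist_eq, Subtype.dist_eq, ← mul_sub, abs_mul]
  have h_left : LipschitzWith (1 * 2) left := (LipschitzWith.projIcc zero_le_one).comp h_double
  have h_right : LipschitzWith (1 * (2 + 0)) right :=
    (LipschitzWith.projIcc zero_le_one).comp (h_double.sub (.const 1))
  refine ⟨fun θ => γ₁ (left θ) + (γ₂ (right θ) - y),
    ⟨_, (hK₁.comp h_left).add ((hK₂.comp h_right).sub (.const y))⟩, ?_, ?_, ?_⟩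
  · have : right 0 = 0 := projIcc_of_le_left _ (by norm_num)
    have : left 0 = 0 := projIcc_of_le_left _ (by norm_num)
    simp [*]
  · have : right 1 = 1 := projIcc_of_right_le _ (by norm_num)
    have : left 1 = 1 := projIcc_of_right_le _ (by norm_num)
    simp [*]
  · rintro _ ⟨θ, rfl⟩
    rcases le_total (2 * (θ : ℝ)) 1 with hθ | hθ
    · have : right θ = 0 := projIcc_of_le_left _ (by linarith)
      exact Or.inl (by simpa [this, hy'] using hA (mem_range_self (left θ)))
    · have : left θ = 1 := projIcc_of_right_le _ hθ
      exact Or.inr (by simpa [this, hy] using hB (mem_range_self (right θ)))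

theorem lipschitzJoined_segment (x y : EuclideanSpace ℝ (Fin n)) :
    LipschitzJoined (segment ℝ x y) x y := by
  refine ⟨fun θ => AffineMap.lineMap x y (θ : ℝ),
    ⟨_, (lipschitzWith_lineMap x y).comp (LipschitzWith.subtype_val _)⟩, by simp, by simp, ?_⟩
  rw [segment_eq_image_lineMap]
  rintro _ ⟨θ, rfl⟩
  exact mem_image_of_mem _ θ.2

theorem lipschitzJoined_image_Icc {K : ℝ≥0} (hK : LipschitzWith K γ) {s t : unitInterval}
    (hst : s ≤ t) : LipschitzJoined (γ '' Icc s t) (γ s) (γ t) := by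
  have clamp_lipschitz : LipschitzWith 1 fun θ : unitInterval => max s (min t θ) := by
    refine .of_dist_le_mul fun θ θ' => ?_
    simpa [Subtype.dist_eq, (Subtype.mono_coe (· ∈ unitInterval)).map_max,
      (Subtype.mono_coe (· ∈ unitInterval)).map_min] using
      (((LipschitzWith.subtype_val unitInterval).const_min (t : ℝ)).const_max
        (s : ℝ)).dist_le_mul θ θ'
  refine ⟨fun θ => γ (max s (min t θ)), ⟨_, hK.comp clamp_lipschitz⟩, ?_, ?_, ?_⟩
  · simp
  · change γ (max s (min t 1)) = γ t
    rw [min_eq_left unitInterval.le_one', max_eq_right hst]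
  · rintro _ ⟨θ, rfl⟩
    exact ⟨_, ⟨le_max_left _ _, max_le hst (min_le_left _ _)⟩, rfl⟩

theorem curveCost_le_hausdorffMeasure (h : LipschitzJoined A x y) (hA : A ⊆ closure Ω) :
    curveCost Ω Z x y ≤ μH[1] (A \ Z) :=
  let ⟨γ, hlip, h0, h1, hγ⟩ := h
  (iInf₂_le γ ⟨hlip, h0, h1, hγ.trans hA⟩).trans (measure_mono (sdiff_subset_sdiff_left hγ))

theorem geodesicDist_le_hausdorffMeasure (h : LipschitzJoined A x y) (hA : A ⊆ closure Ω) :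
    geodesicDist Ω x y ≤ μH[1] A := by
  simpa [geodesicDist] using curveCost_le_hausdorffMeasure (Z := ∅) h hA

theorem curveCost_triangle : curveCost Ω Z x z ≤ curveCost Ω Z x y + curveCost Ω Z y z := by
  conv_rhs => unfold curveCost
  simp only [ENNReal.iInf_add, ENNReal.add_iInf]
  refine le_iInf₂ fun γ₂ h₂ => le_iInf₂ fun γ₁ h₁ => ?_
  refine (curveCost_le_hausdorffMeasure (h₁.joined_range.trans h₂.joined_range)
    (union_subset h₁.2.2.2 h₂.2.2.2)).trans ?_
  rw [union_sdiff_distrib]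
  exact measure_union_le _ _

theorem curveCost_comm : curveCost Ω Z x y = curveCost Ω Z y x := by
  have h_le (a b : EuclideanSpace ℝ (Fin n)) : curveCost Ω Z a b ≤ curveCost Ω Z b a :=
    le_iInf₂ fun γ hγ => curveCost_le_hausdorffMeasure hγ.joined_range.symm hγ.2.2.2
  exact le_antisymm (h_le x y) (h_le y x)

theorem curveCost_anti_right (h : A ⊆ B) : curveCost Ω B x y ≤ curveCost Ω A x y :=
  iInf₂_mono fun _ _ => measure_mono (sdiff_subset_sdiff_right h)

theorem curveCost_le_geodesicDist : curveCost Ω Z x y ≤ geodesicDist Ω x y :=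
  curveCost_anti_right (empty_subset Z)

theorem geodesicDist_triangle : geodesicDist Ω x z ≤ geodesicDist Ω x y + geodesicDist Ω y z :=
  curveCost_triangle

theorem geodesicDist_comm : geodesicDist Ω x y = geodesicDist Ω y x :=
  curveCost_comm

theorem geodesicDist_le_edist (h : segment ℝ x y ⊆ closure Ω) : geodesicDist Ω x y ≤ edist x y :=
  (geodesicDist_le_hausdorffMeasure (lipschitzJoined_segment x y) h).trans_eq
    (hausdorffMeasure_segment x y)

theorem geodesicDist_self (h : x ∈ closure Ω) : geodesicDist Ω x x = 0 := by
  simpa using geodesicDist_le_edist (x := x) (y := x) (by simpa)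

theorem geodesicInfDist_le_add :
    geodesicInfDist Ω Z x ≤ geodesicDist Ω x y + geodesicInfDist Ω Z y := by
  simp only [geodesicInfDist, ENNReal.add_iInf]
  exact iInf₂_mono fun _ _ => geodesicDist_triangle

theorem geodesicInfDist_eq_zero (hx : x ∈ Z) (hxΩ : x ∈ closure Ω) : geodesicInfDist Ω Z x = 0 :=
  nonpos_iff_eq_zero.1 ((iInf₂_le x hx).trans_eq (geodesicDist_self hxΩ))

theorem freeZoneCost_le_geodesicDist : freeZoneCost Ω Z x y ≤ geodesicDist Ω x y :=
  min_le_left _ _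

theorem freeZoneCost_le_of_mem {a b : EuclideanSpace ℝ (Fin n)} (ha : a ∈ Z) (hb : b ∈ Z) :
    freeZoneCost Ω Z x y ≤ geodesicDist Ω x a + geodesicDist Ω y b :=
  (min_le_right _ _).trans (add_le_add (iInf₂_le a ha) (iInf₂_le b hb))

theorem freeZoneCost_self (h : x ∈ closure Ω) : freeZoneCost Ω Z x x = 0 := by
  simp [freeZoneCost, geodesicDist_self h]

theorem freeZoneCost_comm : freeZoneCost Ω Z x y = freeZoneCost Ω Z y x := by
  rw [freeZoneCost, freeZoneCost, geodesicDist_comm, add_comm]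

theorem freeZoneCost_eq_zero (hZ : Z ⊆ closure Ω) (hx : x ∈ Z) (hy : y ∈ Z) :
    freeZoneCost Ω Z x y = 0 := by
  simp [freeZoneCost, geodesicInfDist_eq_zero, hx, hy, hZ hx, hZ hy]

theorem freeZoneCost_triangle :
    freeZoneCost Ω Z x z ≤ freeZoneCost Ω Z x y + freeZoneCost Ω Z y z := by
  have via_infDist : freeZoneCost Ω Z x z ≤ geodesicInfDist Ω Z x + geodesicInfDist Ω Z z :=
    min_le_right _ _
  rcases min_choice (geodesicDist Ω x y) (geodesicInfDist Ω Z x + geodesicInfDist Ω Z y)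
    with hxy | hxy <;>
  rcases min_choice (geodesicDist Ω y z) (geodesicInfDist Ω Z y + geodesicInfDist Ω Z z)
    with hyz | hyz <;>
  rw [freeZoneCost.eq_def _ _ x y, freeZoneCost.eq_def _ _ y z, hxy, hyz]
  · exact freeZoneCost_le_geodesicDist.trans geodesicDist_triangle
  · refine via_infDist.trans ?_
    rw [← add_assoc]
    gcongr
    exact geodesicInfDist_le_add
  · refine via_infDist.trans ?_
    rw [add_assoc, add_comm (geodesicInfDist Ω Z y), geodesicDist_comm]
    gcongr
    exact geodesicInfDist_le_add
  · exact via_infDist.trans (add_le_add le_self_add le_add_self)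

theorem curveCost_le_freeZoneCost (h0 : ∀ a ∈ Z, ∀ b ∈ Z, curveCost Ω Z a b = 0) :
    curveCost Ω Z x y ≤ freeZoneCost Ω Z x y := by
  refine le_min curveCost_le_geodesicDist ?_
  simp only [geodesicInfDist, ENNReal.iInf_add, ENNReal.add_iInf]
  refine le_iInf₂ fun b hb => le_iInf₂ fun a ha => ?_
  calc curveCost Ω Z x y
      ≤ curveCost Ω Z x a + (curveCost Ω Z a b + curveCost Ω Z b y) :=
        curveCost_triangle.trans (by gcongr; exact curveCost_triangle)
    _ = curveCost Ω Z x a + curveCost Ω Z y b := by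
        rw [h0 a ha b hb, zero_add, curveCost_comm (x := b)]
    _ ≤ geodesicDist Ω x a + geodesicDist Ω y b := by
        gcongr <;> exact curveCost_le_geodesicDist

theorem hausdorffMeasure_le_of_inter_subset_pair {X : Type*} [EMetricSpace X] [MeasurableSpace X]
    [BorelSpace X] {A Z : Set X} {p q : X} (h : A ∩ Z ⊆ {p, q}) : μH[1] A ≤ μH[1] (A \ Z) := by
  have := Measure.nullSingletonClass_hausdorff X one_pos
  have h_null : μH[1] (A ∩ Z) = 0 := measure_mono_null h ((toFinite {p, q}).measure_zero _)
  exact (measure_sdiff_null' h_null).ge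

/-- If the arcs before the first and after the last visit to `Z` meet outside `Z`, their union
contains a curve from `x` to `y`; otherwise they are disjoint outside `Z`, and their lengths add
up to at most `ℋ¹(S \ Z)`. -/
theorem freeZoneCost_le_of_isLeast_of_isGreatest (hγ : IsLipschitzCurve (closure Ω) x y γ)
    (hZ : IsClosed Z) {s t : unitInterval} (hs : IsLeast (γ ⁻¹' Z) s)
    (ht : IsGreatest (γ ⁻¹' Z) t) : freeZoneCost Ω Z x y ≤ μH[1] (range γ \ Z) := by
  obtain ⟨⟨K, hK⟩, rfl, rfl, hγΩ⟩ := hγ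
  let P := γ '' Icc 0 s
  let Q := γ '' Icc t 1
  have hPγ : P ⊆ range γ := image_subset_range _ _
  have hQγ : Q ⊆ range γ := image_subset_range _ _
  have hPZ : P ∩ Z ⊆ {γ s} := by
    rintro _ ⟨⟨θ, hθ, rfl⟩, hθZ⟩
    exact congrArg γ (le_antisymm hθ.2 (hs.2 hθZ))
  have hQZ : Q ∩ Z ⊆ {γ t} := by
    rintro _ ⟨⟨θ, hθ, rfl⟩, hθZ⟩
    exact congrArg γ (le_antisymm (ht.2 hθZ) hθ.1)
  by_cases hPQ : Disjoint (P \ Z) (Q \ Z)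
  · have hQ_meas : MeasurableSet (Q \ Z) :=
      (isCompact_Icc.image hK.continuous).measurableSet.diff hZ.measurableSet
    calc freeZoneCost Ω Z (γ 0) (γ 1)
        ≤ geodesicDist Ω (γ 0) (γ s) + geodesicDist Ω (γ 1) (γ t) :=
          freeZoneCost_le_of_mem hs.1 ht.1
      _ ≤ μH[1] P + μH[1] Q := add_le_add
          (geodesicDist_le_hausdorffMeasure (lipschitzJoined_image_Icc hK s.2.1) (hPγ.trans hγΩ))
          (geodesicDist_le_hausdorffMeasure (lipschitzJoined_image_Icc hK t.2.2).symm
            (hQγ.trans hγΩ))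
      _ ≤ μH[1] (P \ Z) + μH[1] (Q \ Z) := add_le_add
          (hausdorffMeasure_le_of_inter_subset_pair (hPZ.trans (subset_insert (γ s) _)))
          (hausdorffMeasure_le_of_inter_subset_pair (hQZ.trans (subset_insert (γ t) _)))
      _ = μH[1] (P \ Z ∪ Q \ Z) := (measure_union hPQ hQ_meas).symm
      _ ≤ μH[1] (range γ \ Z) := measure_mono
          (union_subset (sdiff_subset_sdiff_left hPγ) (sdiff_subset_sdiff_left hQγ))
  · obtain ⟨_, ⟨⟨θ, hθ, rfl⟩, -⟩, ⟨θ', hθ', h_eq⟩, -⟩ := not_disjoint_iff.1 hPQ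
    have h_joined : LipschitzJoined (P ∪ Q) (γ 0) (γ 1) :=
      ((lipschitzJoined_image_Icc hK hθ.1).mono (image_mono (Icc_subset_Icc_right hθ.2))).trans
        (h_eq ▸ (lipschitzJoined_image_Icc hK hθ'.2).mono (image_mono (Icc_subset_Icc_left hθ'.1)))
    calc freeZoneCost Ω Z (γ 0) (γ 1)
        ≤ μH[1] (P ∪ Q) := freeZoneCost_le_geodesicDist.trans
          (geodesicDist_le_hausdorffMeasure h_joined ((union_subset hPγ hQγ).trans hγΩ))
      _ ≤ μH[1] ((P ∪ Q) \ Z) := hausdorffMeasure_le_of_inter_subset_pair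
          (by rw [union_inter_distrib_right]; exact union_subset_union hPZ hQZ)
      _ ≤ μH[1] (range γ \ Z) := measure_mono (sdiff_subset_sdiff_left (union_subset hPγ hQγ))

theorem freeZoneCost_le_curveCost (hZ : IsClosed Z) :
    freeZoneCost Ω Z x y ≤ curveCost Ω Z x y := by
  refine le_iInf₂ fun γ hγ => ?_
  have hcomp : IsCompact (γ ⁻¹' Z) := (hZ.preimage hγ.continuous).isCompact
  rcases (γ ⁻¹' Z).eq_empty_or_nonempty with hempty | hne
  · have : range γ \ Z = range γ := (preimage_eq_empty_iff.1 hempty).symm.sdiff_eq_left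
    rw [this]
    exact freeZoneCost_le_geodesicDist.trans
      (geodesicDist_le_hausdorffMeasure hγ.joined_range hγ.2.2.2)
  · obtain ⟨s, hs⟩ := hcomp.exists_isLeast hne
    obtain ⟨t, ht⟩ := hcomp.exists_isGreatest hne
    exact freeZoneCost_le_of_isLeast_of_isGreatest hγ hZ hs ht

end Curves

section Domain

variable {n : ℕ} {Ω : Set (EuclideanSpace ℝ (Fin n))} {p e x y : EuclideanSpace ℝ (Fin n)}
  {L : ℝ≥0} {r s : ℝ}

/-- Near `p`, the set `Ω` has the inward cone property in the direction `e`: inside `ball p r`, the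
translate by `s • e` of every point at distance less than `s / L` from `closure Ω` lies in `Ω`.
This is the only consequence of a Lipschitz boundary that the proof uses. -/
structure HasInwardCone (Ω : Set (EuclideanSpace ℝ (Fin n))) (p e : EuclideanSpace ℝ (Fin n))
    (L : ℝ≥0) (r : ℝ) : Prop where
  norm_eq_one : ‖e‖ = 1
  radius_pos : 0 < r
  add_smul_mem : ∀ x ∈ closure Ω, x ∈ Metric.ball p r → ∀ (w : EuclideanSpace ℝ (Fin n)) (s : ℝ),
    L * dist w x < s → w + s • e ∈ Metric.ball p r → w + s • e ∈ Ω

theorem HasLipschitzBoundary.exists_hasInwardCone (h : HasLipschitzBoundary Ω)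
    (hp : p ∈ frontier Ω) : ∃ e L r, HasInwardCone Ω p e L r := by
  obtain ⟨e, he, K, g, hg, hg_add, U, hU, hUΩ⟩ := h p hp
  obtain ⟨r, hr, hrU⟩ := Metric.mem_nhds_iff.1 hU
  refine ⟨e, K + 1, r, he, hr, fun x hx hxr w s hs hws => (hUΩ _ (hrU hws)).2 ?_⟩
  have h_above : g x ≤ inner ℝ e x :=
    closure_minimal (fun y hy => ((hUΩ y (hrU hy.1)).1 hy.2).le)
      (isClosed_le hg.continuous (by fun_prop)) (Metric.isOpen_ball.inter_closure ⟨hxr, hx⟩)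
  have hg_le : g w ≤ g x + K * dist w x := hg.le_add_mul w x
  have h_inner : inner ℝ e x ≤ inner ℝ e w + dist w x := by
    have := real_inner_le_norm e (x - w)
    rw [inner_sub_right, he, one_mul, ← dist_eq_norm, dist_comm] at this
    linarith
  rw [hg_add, inner_add_right, inner_smul_right, real_inner_self_eq_norm_sq, he]
  push_cast at hs
  linarith

namespace HasInwardCone

theorem add_smul_mem_ball (h : HasInwardCone Ω p e L r) (hs : 0 ≤ s) (hxr : dist x p + s < r) :
    x + s • e ∈ Metric.ball p r := by
  have h_dist : dist (x + s • e) x = s := by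
    rw [dist_eq_norm, add_sub_cancel_left, norm_smul, h.norm_eq_one, mul_one,
      Real.norm_of_nonneg hs]
  rw [Metric.mem_ball]
  linarith [dist_triangle (x + s • e) x p]

theorem geodesicDist_add_smul_le (h : HasInwardCone Ω p e L r) (hx : x ∈ closure Ω) (hs : 0 ≤ s)
    (hxr : dist x p + s < r) : geodesicDist Ω x (x + s • e) ≤ ENNReal.ofReal s := by
  have h_segment : segment ℝ x (x + s • e) ⊆ closure Ω := by
    rw [segment_eq_image']
    rintro _ ⟨θ, hθ, rfl⟩
    have hθs : 0 ≤ θ * s := mul_nonneg hθ.1 hs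
    simp only [add_sub_cancel_left, smul_smul]
    rcases hθs.eq_or_lt with h_zero | h_pos
    · rwa [← h_zero, zero_smul, add_zero]
    · refine subset_closure (h.add_smul_mem x hx (by rw [Metric.mem_ball]; linarith) x _
        (by simpa using h_pos) (h.add_smul_mem_ball hθs ?_))
      linarith [mul_le_of_le_one_left hs hθ.2]
  calc geodesicDist Ω x (x + s • e) ≤ edist x (x + s • e) := geodesicDist_le_edist h_segment
    _ = ENNReal.ofReal s := by
      rw [edist_dist, dist_self_add_right, norm_smul, h.norm_eq_one, mul_one,
        Real.norm_of_nonneg hs]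

theorem geodesicDist_add_smul_add_smul_le (h : HasInwardCone Ω p e L r) (hx : x ∈ closure Ω)
    (hs : L * dist x y < s) (hxr : dist x p + s < r) (hyr : dist y p + s < r) :
    geodesicDist Ω (x + s • e) (y + s • e) ≤ edist x y := by
  have hs_pos : 0 < s := lt_of_le_of_lt (by positivity) hs
  refine (geodesicDist_le_edist ?_).trans_eq (edist_add_right _ _ _)
  have h_translate : segment ℝ (x + s • e) (y + s • e) = (· + s • e) '' segment ℝ x y := by
    simpa [add_comm] using (segment_translate_image ℝ (s • e) x y).symm
  rw [h_translate]
  rintro _ ⟨w, hw, rfl⟩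
  have hwx : dist w x ≤ dist x y := by
    rw [dist_comm w x]
    linarith [dist_add_dist_of_mem_segment hw, dist_nonneg (x := w) (y := y)]
  have hwp : dist w p < r - s := (convex_ball p (r - s)).segment_subset
    (Metric.mem_ball.2 (by linarith)) (Metric.mem_ball.2 (by linarith)) hw
  refine subset_closure (h.add_smul_mem x hx (by rw [Metric.mem_ball]; linarith) w s ?_
    (h.add_smul_mem_ball hs_pos.le (by linarith)))
  exact (mul_le_mul_of_nonneg_left hwx L.2).trans_lt hs

/-- Go up by `(L + 1) * dist x y` in the direction `e`, move horizontally, and come down. -/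
theorem geodesicDist_le (h : HasInwardCone Ω p e L r) (hx : x ∈ closure Ω) (hy : y ∈ closure Ω)
    (hxr : dist x p < r / (2 * L + 3)) (hyr : dist y p < r / (2 * L + 3)) :
    geodesicDist Ω x y ≤ (2 * L + 3 : ℝ≥0) * edist x y := by
  rcases eq_or_ne x y with rfl | hxy
  · simp [geodesicDist_self hx]
  set s : ℝ := (L + 1) * dist x y with hs
  have h_dist : dist x y < 2 * (r / (2 * L + 3)) := by linarith [dist_triangle_right x y p]
  have hr : r / (2 * L + 3) + (L + 1) * (2 * (r / (2 * L + 3))) = r := by field_simp; ring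
  have hs_lt : s < (L + 1) * (2 * (r / (2 * L + 3))) := by rw [hs]; gcongr
  have hs_gt : L * dist x y < s := by rw [hs]; linarith [dist_pos.2 hxy]
  have hs_nonneg : 0 ≤ s := by positivity
  have hxs : dist x p + s < r := by linarith
  have hys : dist y p + s < r := by linarith
  have hsE : ENNReal.ofReal s = (L + 1 : ℝ≥0) * edist x y := by
    rw [hs, edist_dist, ENNReal.ofReal_mul (by positivity), ← ENNReal.ofReal_coe_nnreal]
    simp
  calc geodesicDist Ω x y
      ≤ geodesicDist Ω x (x + s • e) + (geodesicDist Ω (x + s • e) (y + s • e)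
          + geodesicDist Ω (y + s • e) y) :=
        geodesicDist_triangle.trans (add_le_add le_rfl geodesicDist_triangle)
    _ ≤ ENNReal.ofReal s + (edist x y + ENNReal.ofReal s) := by
        gcongr
        · exact h.geodesicDist_add_smul_le hx hs_nonneg hxs
        · exact h.geodesicDist_add_smul_add_smul_le hx hs_gt hxs hys
        · exact geodesicDist_comm.trans_le (h.geodesicDist_add_smul_le hy hs_nonneg hys)
    _ = (2 * L + 3 : ℝ≥0) * edist x y := by
        rw [hsE]
        push_cast
        ring

end HasInwardCone

variable {Z : Set (EuclideanSpace ℝ (Fin n))}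

theorem exists_geodesicDist_le_mul_edist (hΩ : IsOpen Ω) (h : HasLipschitzBoundary Ω)
    (hp : p ∈ closure Ω) :
    ∃ C : ℝ≥0, ∀ᶠ x in 𝓝[closure Ω] p, geodesicDist Ω p x ≤ C * edist p x := by
  by_cases hpΩ : p ∈ Ω
  · obtain ⟨r, hr, hrΩ⟩ := Metric.isOpen_iff.1 hΩ p hpΩ
    refine ⟨1, nhdsWithin_le_nhds ?_⟩
    filter_upwards [Metric.ball_mem_nhds p hr] with x hx
    rw [ENNReal.coe_one, one_mul]
    exact geodesicDist_le_edist (((convex_ball p r).segment_subset (Metric.mem_ball_self hr)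
      hx).trans (hrΩ.trans subset_closure))
  · obtain ⟨e, L, r, hcone⟩ := h.exists_hasInwardCone ⟨hp, by rwa [hΩ.interior_eq]⟩
    have hρ : 0 < r / (2 * L + 3) := div_pos hcone.radius_pos (by positivity)
    refine ⟨2 * L + 3, ?_⟩
    filter_upwards [self_mem_nhdsWithin, nhdsWithin_le_nhds (Metric.ball_mem_nhds p hρ)]
      with x hx hxr
    exact hcone.geodesicDist_le hp hx (by rwa [dist_self]) hxr

theorem tendsto_geodesicDist_zero (hΩ : IsOpen Ω) (h : HasLipschitzBoundary Ω)
    (hp : p ∈ closure Ω) : Filter.Tendsto (geodesicDist Ω p) (𝓝[closure Ω] p) (𝓝 0) := by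
  obtain ⟨C, hC⟩ := exists_geodesicDist_le_mul_edist hΩ h hp
  have h_lim : Filter.Tendsto (fun x => C * edist p x) (𝓝[closure Ω] p) (𝓝 0) := by
    have : Continuous fun x => (C : ℝ≥0∞) * edist p x :=
      (ENNReal.continuous_const_mul ENNReal.coe_ne_top).comp (by fun_prop)
    simpa using (this.tendsto p).mono_left nhdsWithin_le_nhds
  exact tendsto_of_tendsto_of_tendsto_of_le_of_le' tendsto_const_nhds h_lim
    (Filter.Eventually.of_forall fun _ => zero_le) hC

theorem geodesicDist_lt_top (hΩ : IsOpen Ω) (hconn : IsPreconnected Ω)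
    (h : HasLipschitzBoundary Ω) (hx : x ∈ closure Ω) (hy : y ∈ closure Ω) :
    geodesicDist Ω x y < ⊤ :=
  hconn.closure.induction₂ (fun x y => geodesicDist Ω x y < ⊤)
    (fun _ hx => (tendsto_geodesicDist_zero hΩ h hx).eventually_lt_const ENNReal.zero_lt_top)
    (fun _ _ _ _ _ _ hxy hyz => geodesicDist_triangle.trans_lt (ENNReal.add_lt_top.2 ⟨hxy, hyz⟩))
    (fun _ _ _ _ hxy => geodesicDist_comm.trans_lt hxy) hx hy

theorem freeZoneCost_lt_top (hΩ : IsOpen Ω) (hconn : IsPreconnected Ω)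
    (h : HasLipschitzBoundary Ω) (hx : x ∈ closure Ω) (hy : y ∈ closure Ω) :
    freeZoneCost Ω Z x y < ⊤ :=
  freeZoneCost_le_geodesicDist.trans_lt (geodesicDist_lt_top hΩ hconn h hx hy)

theorem continuous_of_triangle {X : Type*} [TopologicalSpace X] {c : X → X → ℝ≥0∞}
    (hsymm : ∀ x y, c x y = c y x) (htri : ∀ x y z, c x z ≤ c x y + c y z)
    (hlim : ∀ x, Filter.Tendsto (c x) (𝓝 x) (𝓝 0)) : Continuous fun p : X × X => c p.1 p.2 := by
  refine continuous_iff_continuousAt.2 fun ⟨x, y⟩ => ?_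
  have h_sum : Filter.Tendsto (fun p : X × X => c x p.1 + c y p.2) (𝓝 (x, y)) (𝓝 0) := by
    simpa using ((hlim x).comp (continuous_fst.tendsto (x, y))).add
      ((hlim y).comp (continuous_snd.tendsto (x, y)))
  have h_lower : Filter.Tendsto (fun p : X × X => c x y - (c x p.1 + c y p.2)) (𝓝 (x, y))
      (𝓝 (c x y)) := by
    simpa using ENNReal.Tendsto.sub tendsto_const_nhds h_sum (Or.inr ENNReal.zero_ne_top)
  have h_upper : Filter.Tendsto (fun p : X × X => c x y + (c x p.1 + c y p.2)) (𝓝 (x, y))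
      (𝓝 (c x y)) := by
    simpa using (tendsto_const_nhds (x := c x y)).add h_sum
  refine tendsto_of_tendsto_of_tendsto_of_le_of_le h_lower h_upper (fun p => ?_) fun p => ?_
  · refine tsub_le_iff_right.2 ?_
    calc c x y ≤ c x p.1 + (c p.1 p.2 + c p.2 y) :=
          (htri _ p.1 _).trans (add_le_add le_rfl (htri _ p.2 _))
      _ = c p.1 p.2 + (c x p.1 + c y p.2) := by rw [hsymm p.2 y]; ring
  · calc c p.1 p.2 ≤ c p.1 x + (c x y + c y p.2) :=
          (htri _ x _).trans (add_le_add le_rfl (htri _ y _))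
      _ = c x y + (c x p.1 + c y p.2) := by rw [hsymm p.1 x]; ring

theorem tendsto_freeZoneCost_zero (hΩ : IsOpen Ω) (h : HasLipschitzBoundary Ω)
    (hp : p ∈ closure Ω) : Filter.Tendsto (freeZoneCost Ω Z p) (𝓝[closure Ω] p) (𝓝 0) :=
  tendsto_of_tendsto_of_tendsto_of_le_of_le tendsto_const_nhds (tendsto_geodesicDist_zero hΩ h hp)
    (fun _ => zero_le) fun _ => freeZoneCost_le_geodesicDist

theorem continuous_freeZoneCost (hΩ : IsOpen Ω) (h : HasLipschitzBoundary Ω) :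
    Continuous fun p : closure Ω × closure Ω => freeZoneCost Ω Z p.1 p.2 :=
  continuous_of_triangle (c := fun x y : closure Ω => freeZoneCost Ω Z x y)
    (fun _ _ => freeZoneCost_comm) (fun _ _ _ => freeZoneCost_triangle) fun x => by
      have := tendsto_freeZoneCost_zero (Z := Z) hΩ h x.2
      rwa [nhdsWithin_eq_map_subtype_coe x.2, Filter.tendsto_map'_iff] at this

end Domain

section LocallyLipschitz

theorem hausdorffMeasure_image_le_of_locally_lipschitz {X Y : Type*} [MetricSpace X]
    [SecondCountableTopology X] [MeasurableSpace X] [BorelSpace X] [MetricSpace Y]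
    [MeasurableSpace Y] [BorelSpace Y] {f : X → Y} {K : ℝ≥0} {S : Set X} {d : ℝ} (hd : 0 ≤ d)
    (hS : MeasurableSet S) (hf : ∀ x ∈ S, ∃ U ∈ 𝓝 x, LipschitzOnWith K f U) :
    μH[d] (f '' S) ≤ (K : ℝ≥0∞) ^ d * μH[d] S := by
  rcases S.eq_empty_or_nonempty with rfl | hne
  · simp
  choose! U hU hUf using hf
  obtain ⟨t, htS, ht_countable, hSt⟩ := TopologicalSpace.countable_cover_nhdsWithin
    (f := fun x => interior (U x)) (s := S)
    fun x hx => nhdsWithin_le_nhds (interior_mem_nhds.2 (hU x hx))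
  have ht_nonempty : t.Nonempty := by
    by_contra! h
    simp [h, hne.ne_empty] at hSt
  obtain ⟨a, rfl⟩ := ht_countable.exists_eq_range ht_nonempty
  let V : ℕ → Set X := fun i => interior (U (a i))
  have h_cover : ⋃ i, S ∩ disjointed V i = S := by
    rw [← inter_iUnion, iUnion_disjointed, inter_eq_left]
    simpa [V] using hSt
  have h_meas (i : ℕ) : MeasurableSet (S ∩ disjointed V i) :=
    hS.inter (MeasurableSet.disjointed (fun _ => isOpen_interior.measurableSet) i)
  have h_disj : Pairwise (Function.onFun Disjoint fun i => S ∩ disjointed V i) := fun i j hij =>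
    (disjoint_disjointed V hij).mono inter_subset_right inter_subset_right
  have h_lip (i : ℕ) : LipschitzOnWith K f (S ∩ disjointed V i) :=
    (hUf (a i) (htS ⟨i, rfl⟩)).mono
      (inter_subset_right.trans ((disjointed_subset V i).trans interior_subset))
  calc μH[d] (f '' S)
      = μH[d] (⋃ i, f '' (S ∩ disjointed V i)) := by rw [← image_iUnion, h_cover]
    _ ≤ ∑' i, μH[d] (f '' (S ∩ disjointed V i)) := measure_iUnion_le _
    _ ≤ ∑' i, (K : ℝ≥0∞) ^ d * μH[d] (S ∩ disjointed V i) :=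
        ENNReal.tsum_le_tsum fun i => (h_lip i).hausdorffMeasure_image_le hd
    _ = (K : ℝ≥0∞) ^ d * μH[d] S := by
        rw [ENNReal.tsum_mul_left, ← measure_iUnion h_disj h_meas, h_cover]

variable {n : ℕ} {Ω Z : Set (EuclideanSpace ℝ (Fin n))} {x y : EuclideanSpace ℝ (Fin n)}
  {φ : EuclideanSpace ℝ (Fin n) → ℝ} {K : ℝ≥0}

theorem edist_le_mul_hausdorffMeasure_range {γ : unitInterval → EuclideanSpace ℝ (Fin n)}
    (hγ : Continuous γ) (hf : ∀ x ∈ range γ, ∃ U ∈ 𝓝 x, LipschitzOnWith K φ U) :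
    edist (φ (γ 0)) (φ (γ 1)) ≤ K * μH[1] (range γ) := by
  have hφ : ContinuousOn φ (range γ) := fun z hz =>
    let ⟨_, hU, hUf⟩ := hf z hz
    (hUf.continuousOn.continuousAt hU).continuousWithinAt
  have h_uIcc : uIcc (φ (γ 1)) (φ (γ 0)) ⊆ φ '' range γ :=
    ((isPreconnected_range hγ).image φ hφ).ordConnected.uIcc_subset
      ⟨_, ⟨1, rfl⟩, rfl⟩ ⟨_, ⟨0, rfl⟩, rfl⟩
  calc edist (φ (γ 0)) (φ (γ 1)) = μH[1] (uIcc (φ (γ 1)) (φ (γ 0))) := by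
        rw [hausdorffMeasure_real, Real.volume_interval, edist_dist, Real.dist_eq]
    _ ≤ μH[1] (φ '' range γ) := measure_mono h_uIcc
    _ ≤ K * μH[1] (range γ) := by
        simpa using hausdorffMeasure_image_le_of_locally_lipschitz zero_le_one
          (isCompact_range hγ).measurableSet hf

theorem edist_le_mul_geodesicDist (hK : K ≠ 0)
    (hf : ∀ x ∈ closure Ω, ∃ U ∈ 𝓝 x, LipschitzOnWith K φ U) :
    edist (φ x) (φ y) ≤ K * geodesicDist Ω x y := by
  have hK' : (K : ℝ≥0∞) ≠ 0 := by simpa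
  simp only [geodesicDist, curveCost, sdiff_empty,
    ENNReal.mul_iInf_of_ne hK' ENNReal.coe_ne_top]
  refine le_iInf₂ fun γ hγ => ?_
  rw [← hγ.2.1, ← hγ.2.2.1]
  exact edist_le_mul_hausdorffMeasure_range hγ.continuous fun z hz => hf z (hγ.2.2.2 hz)

theorem edist_le_mul_freeZoneCost (hK : K ≠ 0)
    (hf : ∀ x ∈ closure Ω, ∃ U ∈ 𝓝 x, LipschitzOnWith K φ U) (hφ : ∀ z ∈ Z, φ z = 0) :
    edist (φ x) (φ y) ≤ K * freeZoneCost Ω Z x y := by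
  have hK' : (K : ℝ≥0∞) ≠ 0 := by simpa
  have edist_zero_le (w : EuclideanSpace ℝ (Fin n)) :
      edist (φ w) 0 ≤ K * geodesicInfDist Ω Z w := by
    simp only [geodesicInfDist, ENNReal.mul_iInf_of_ne hK' ENNReal.coe_ne_top]
    refine le_iInf₂ fun z hz => ?_
    rw [← hφ z hz]
    exact edist_le_mul_geodesicDist hK hf
  rcases min_choice (geodesicDist Ω x y) (geodesicInfDist Ω Z x + geodesicInfDist Ω Z y)
    with h | h <;> rw [freeZoneCost, h]
  · exact edist_le_mul_geodesicDist hK hf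
  · rw [mul_add]
    exact (edist_triangle_right _ _ 0).trans (add_le_add (edist_zero_le x) (edist_zero_le y))

theorem exists_lipschitzOnWith_of_norm_gradient_lt (hφ : ContDiffAt ℝ 1 φ x)
    (hgrad : ‖gradient φ x‖ < K) : ∃ U ∈ 𝓝 x, LipschitzOnWith K φ U := by
  refine hφ.exists_lipschitzOnWith_of_nnnorm_lt K ?_
  rwa [gradient, LinearIsometryEquiv.norm_map] at hgrad

theorem geodesicInfDist_le_geodesicInfDist_closure (hΩ : IsOpen Ω) (h : HasLipschitzBoundary Ω)
    (hZ : Z ⊆ closure Ω) : geodesicInfDist Ω Z x ≤ geodesicInfDist Ω (closure Z) x := by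
  refine le_iInf₂ fun z hz => ?_
  have : (𝓝[Z] z).NeBot := mem_closure_iff_nhdsWithin_neBot.1 hz
  have h_lim : Filter.Tendsto (fun w => geodesicDist Ω x z + geodesicDist Ω z w) (𝓝[Z] z)
      (𝓝 (geodesicDist Ω x z)) := by
    simpa using tendsto_const_nhds.add ((tendsto_geodesicDist_zero hΩ h
      (closure_minimal hZ isClosed_closure hz)).mono_left (nhdsWithin_mono z hZ))
  refine ge_of_tendsto h_lim ?_
  filter_upwards [self_mem_nhdsWithin] with w hw
  exact (iInf₂_le w hw).trans geodesicDist_triangle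

theorem freeZoneCost_le_freeZoneCost_closure (hΩ : IsOpen Ω) (h : HasLipschitzBoundary Ω)
    (hZ : Z ⊆ closure Ω) : freeZoneCost Ω Z x y ≤ freeZoneCost Ω (closure Z) x y :=
  min_le_min le_rfl (add_le_add (geodesicInfDist_le_geodesicInfDist_closure hΩ h hZ)
    (geodesicInfDist_le_geodesicInfDist_closure hΩ h hZ))

end LocallyLipschitz

section InwardPush

variable {n : ℕ} {Ω U U' : Set (EuclideanSpace ℝ (Fin n))} {K K' : ℝ≥0} {ε ε' : ℝ}
  {Φ Φ' : EuclideanSpace ℝ (Fin n) → EuclideanSpace ℝ (Fin n)}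

/-- `Φ` is a `K`-Lipschitz map with displacement at most `ε` which pushes the part of `closure Ω`
in `U` into `Ω`. Fixing the points that it does not push into `Ω` makes the notion stable under
composition. -/
structure IsInwardPush (Ω U : Set (EuclideanSpace ℝ (Fin n))) (K : ℝ≥0) (ε : ℝ)
    (Φ : EuclideanSpace ℝ (Fin n) → EuclideanSpace ℝ (Fin n)) : Prop where
  lipschitz : LipschitzWith K Φ
  dist_le : ∀ x, dist (Φ x) x ≤ ε
  eq_or_mem : ∀ x ∈ closure Ω, Φ x = x ∨ Φ x ∈ Ω
  mem : ∀ x ∈ closure Ω, x ∈ U → Φ x ∈ Ω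

namespace IsInwardPush

theorem mono (h : IsInwardPush Ω U K ε Φ) (hU : U' ⊆ U) : IsInwardPush Ω U' K ε Φ :=
  ⟨h.lipschitz, h.dist_le, h.eq_or_mem, fun x hx hxU => h.mem x hx (hU hxU)⟩

theorem mapsTo (h : IsInwardPush Ω U K ε Φ) : MapsTo Φ Ω Ω := fun x hx =>
  (h.eq_or_mem x (subset_closure hx)).elim (fun h_eq => h_eq.symm ▸ hx) id

theorem comp (h : IsInwardPush Ω U K ε Φ) (h' : IsInwardPush Ω U' K' ε' Φ') :
    IsInwardPush Ω (U ∪ U') (K * K') (ε + ε') (Φ ∘ Φ') where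
  lipschitz := h.lipschitz.comp h'.lipschitz
  dist_le x := (dist_triangle _ (Φ' x) _).trans (add_le_add (h.dist_le _) (h'.dist_le x))
  eq_or_mem x hx := by
    rcases h'.eq_or_mem x hx with h_eq | h_mem
    · simpa only [Function.comp_apply, h_eq] using h.eq_or_mem x hx
    · exact Or.inr (h.mapsTo h_mem)
  mem x hx hxU := by
    rcases h'.eq_or_mem x hx with h_eq | h_mem
    · rcases hxU with hxU | hxU'
      · simpa only [Function.comp_apply, h_eq] using h.mem x hx hxU
      · exact h.mapsTo (h'.mem x hx hxU')
    · exact h.mapsTo h_mem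

end IsInwardPush

theorem isInwardPush_id (hK : 1 ≤ K) (hε : 0 ≤ ε) : IsInwardPush Ω Ω K ε id where
  lipschitz := LipschitzWith.id.weaken hK
  dist_le x := by simpa using hε
  eq_or_mem _ _ := Or.inl rfl
  mem _ _ hx := hx

theorem HasInwardCone.isInwardPush {p e : EuclideanSpace ℝ (Fin n)} {L t : ℝ≥0} {r : ℝ}
    (h : HasInwardCone Ω p e L r) (ht : 0 < t) (ht1 : t ≤ 1) :
    IsInwardPush Ω (Metric.ball p (r / 2)) (1 + t) (t * (r / 2))
      fun x => x + (t * max (r / 2 - dist x p) 0) • e := by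
  have hr := h.radius_pos
  have h_mem (x : EuclideanSpace ℝ (Fin n)) (hx : x ∈ closure Ω) (hxp : dist x p < r / 2) :
      x + (t * max (r / 2 - dist x p) 0) • e ∈ Ω := by
    rw [max_eq_left (by linarith)]
    have h_pos : 0 < t * (r / 2 - dist x p) := mul_pos ht (by linarith)
    have h_le : t * (r / 2 - dist x p) ≤ r / 2 - dist x p :=
      mul_le_of_le_one_left (by linarith) ht1
    exact h.add_smul_mem x hx (Metric.mem_ball.2 (by linarith)) x _ (by simpa using h_pos)
      (h.add_smul_mem_ball h_pos.le (by linarith))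
  refine ⟨LipschitzWith.id.add (LipschitzWith.of_dist_le_mul fun x y => ?_), fun x => ?_,
    fun x hx => ?_, h_mem⟩
  · rw [dist_eq_norm, ← sub_smul, norm_smul, h.norm_eq_one, mul_one, ← mul_sub, norm_mul,
      Real.norm_of_nonneg t.coe_nonneg]
    refine mul_le_mul_of_nonneg_left ((abs_max_sub_max_le_abs _ _ _).trans ?_) t.2
    rw [sub_sub_sub_cancel_left, abs_sub_comm]
    exact abs_dist_sub_le x y p
  · rw [dist_eq_norm, add_sub_cancel_left, norm_smul, h.norm_eq_one, mul_one,
      Real.norm_of_nonneg (by positivity)]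
    exact mul_le_mul_of_nonneg_left
      (max_le (sub_le_self _ dist_nonneg) (half_pos hr).le) t.2
  · rcases lt_or_ge (dist x p) (r / 2) with hxp | hxp
    · exact Or.inr (h_mem x hx hxp)
    · exact Or.inl (by simp [max_eq_right (sub_nonpos.2 hxp)])

theorem exists_isInwardPush_nhds (hΩ : IsOpen Ω) (hlip : HasLipschitzBoundary Ω)
    {p : EuclideanSpace ℝ (Fin n)} (hp : p ∈ closure Ω) :
    ∃ U ∈ 𝓝 p, ∀ K : ℝ≥0, 1 < K → ∀ ε > 0, ∃ Φ, IsInwardPush Ω U K ε Φ := by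
  by_cases hpΩ : p ∈ Ω
  · exact ⟨Ω, hΩ.mem_nhds hpΩ, fun K hK ε hε => ⟨id, isInwardPush_id hK.le hε.le⟩⟩
  · obtain ⟨e, L, r, hcone⟩ := hlip.exists_hasInwardCone ⟨hp, by rwa [hΩ.interior_eq]⟩
    have hr : 0 < r / 2 := half_pos hcone.radius_pos
    refine ⟨_, Metric.ball_mem_nhds p hr, fun K hK ε hε => ?_⟩
    obtain ⟨t, ht, ht1, htK, htε⟩ : ∃ t : ℝ≥0, 0 < t ∧ t ≤ 1 ∧ 1 + t ≤ K ∧ t * (r / 2) ≤ ε := by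
      refine ⟨min 1 (min (K - 1) ⟨ε / (r / 2), by positivity⟩), ?_, min_le_left _ _, ?_, ?_⟩
      · exact lt_min one_pos (lt_min (tsub_pos_of_lt hK) (div_pos hε hr))
      · rw [← le_tsub_iff_left hK.le]
        exact (min_le_right _ _).trans (min_le_left _ _)
      · rw [← le_div_iff₀ hr]
        exact NNReal.coe_le_coe.2 ((min_le_right _ _).trans (min_le_right _ _))
    have h_push := hcone.isInwardPush ht ht1
    exact ⟨_, h_push.lipschitz.weaken htK, fun x => (h_push.dist_le x).trans htε,
      h_push.eq_or_mem, h_push.mem⟩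

/-- Compose finitely many local pushes. -/
theorem exists_isInwardPush (hΩ : IsOpen Ω) (hlip : HasLipschitzBoundary Ω)
    (hcomp : IsCompact (closure Ω)) (hK : 1 < K) (hε : 0 < ε) :
    ∃ Φ, IsInwardPush Ω (closure Ω) K ε Φ := by
  refine hcomp.induction_on
    (p := fun U => ∀ K : ℝ≥0, 1 < K → ∀ ε > 0, ∃ Φ, IsInwardPush Ω U K ε Φ)
    (fun K hK ε hε => ?_) (fun U U' hUU' h K hK ε hε => ?_) (fun U U' h h' K hK ε hε => ?_)
    (fun p hp => ?_) K hK ε hε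
  · exact ⟨id, (isInwardPush_id hK.le hε.le).mono (empty_subset Ω)⟩
  · exact (h K hK ε hε).imp fun Φ hΦ => hΦ.mono hUU'
  · have hK' : 1 < NNReal.sqrt K := by simpa using NNReal.sqrt_lt_sqrt.2 hK
    obtain ⟨Φ, hΦ⟩ := h _ hK' _ (half_pos hε)
    obtain ⟨Φ', hΦ'⟩ := h' _ hK' _ (half_pos hε)
    refine ⟨Φ ∘ Φ', ?_⟩
    simpa using hΦ.comp hΦ'
  · obtain ⟨U, hU, h⟩ := exists_isInwardPush_nhds hΩ hlip hp
    exact ⟨U, mem_nhdsWithin_of_mem_nhds hU, h⟩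

theorem IsInwardPush.exists_mapsTo_ball (h : IsInwardPush Ω (closure Ω) K ε Φ) (hΩ : IsOpen Ω)
    (hcomp : IsCompact (closure Ω)) {κ : ℝ} (hκ : 0 < κ) :
    ∃ ρ ≤ κ, ∃ r > 0, ∀ x ∈ closure Ω,
      Metric.ball (Φ x) ρ ⊆ Ω ∧ MapsTo Φ (Metric.ball x r) (Metric.ball (Φ x) ρ) := by
  obtain ⟨ρ, hρ, hρΩ⟩ := (hcomp.image h.lipschitz.continuous).exists_thickening_subset_open hΩ
    (image_subset_iff.2 fun x hx => h.mem x hx hx)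
  obtain ⟨r, hr, hΦr⟩ := Metric.uniformContinuous_iff.1 h.lipschitz.uniformContinuous _
    (lt_min hρ hκ)
  refine ⟨min ρ κ, min_le_right _ _, r, hr, fun x hx => ⟨?_, fun y hy => hΦr hy⟩⟩
  exact (Metric.ball_subset_ball (min_le_left _ _)).trans
    ((Metric.ball_subset_thickening (mem_image_of_mem Φ hx) ρ).trans hρΩ)

end InwardPush

section Mollification

variable {E : Type*} [NormedAddCommGroup E] [NormedSpace ℝ E] [FiniteDimensional ℝ E]
  [HasContDiffBump E] [MeasurableSpace E] [BorelSpace E] {f : E → ℝ} {K : ℝ≥0} {x : E} {r : ℝ}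

theorem lipschitzOnWith_normed_convolution (m : Measure E) [m.IsAddHaarMeasure]
    (ψ : ContDiffBump (0 : E)) (hf : Continuous f)
    (hlip : LipschitzOnWith K f (Metric.ball x (r + ψ.rOut))) :
    LipschitzOnWith K (convolution (ψ.normed m) f (.lsmul ℝ ℝ) m) (Metric.ball x r) := by
  have h_int (y : E) : Integrable (fun t => ψ.normed m t * f (y - t)) m := by
    refine Continuous.integrable_of_hasCompactSupport ?_ ψ.hasCompactSupport_normed.mul_right
    have := ψ.continuous_normed (μ := m)
    fun_prop
  refine LipschitzOnWith.of_dist_le_mul fun y hy y' hy' => ?_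
  have h_bound (t : E) : ‖ψ.normed m t * f (y - t) - ψ.normed m t * f (y' - t)‖
      ≤ ψ.normed m t * (K * dist y y') := by
    rw [← mul_sub, norm_mul, Real.norm_of_nonneg (ψ.nonneg_normed t)]
    rcases eq_or_ne (ψ.normed m t) 0 with h_zero | h_ne
    · simp [h_zero]
    have ht : ‖t‖ < ψ.rOut := by
      rwa [← Function.mem_support, ψ.support_normed_eq, mem_ball_zero_iff] at h_ne
    have h_mem (w : E) (hw : w ∈ Metric.ball x r) : w - t ∈ Metric.ball x (r + ψ.rOut) := by
      rw [Metric.mem_ball] at hw ⊢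
      have : dist (w - t) w = ‖t‖ := by simp
      linarith [dist_triangle (w - t) w x]
    refine mul_le_mul_of_nonneg_left ?_ (ψ.nonneg_normed t)
    simpa [Real.dist_eq] using hlip.dist_le_mul _ (h_mem y hy) _ (h_mem y' hy')
  calc dist (convolution (ψ.normed m) f (.lsmul ℝ ℝ) m y)
        (convolution (ψ.normed m) f (.lsmul ℝ ℝ) m y')
      = ‖∫ t, (ψ.normed m t * f (y - t) - ψ.normed m t * f (y' - t)) ∂m‖ := by
        rw [integral_sub (h_int y) (h_int y')]
        rfl
    _ ≤ ∫ t, ψ.normed m t * (K * dist y y') ∂m :=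
        norm_integral_le_of_norm_le (ψ.integrable_normed.mul_const _)
          (Filter.Eventually.of_forall h_bound)
    _ = K * dist y y' := by rw [integral_mul_const, ψ.integral_normed, one_mul]

theorem exists_contDiff_approx {A : Set E} (hf : Continuous f) (hr : 0 < r)
    (hlip : ∀ x ∈ A, LipschitzOnWith K f (Metric.ball x r)) {η : ℝ} (hη : 0 < η) :
    ∃ h : E → ℝ, ContDiff ℝ ∞ h ∧ (∀ x ∈ A, dist (h x) (f x) ≤ η) ∧
      (∀ x ∈ A, ‖fderiv ℝ h x‖ ≤ K) ∧ ∀ x, (∀ y ∈ Metric.ball x r, f y = 0) → h =ᶠ[𝓝 x] 0 := by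
  obtain ⟨ρ, hρ, hρr, hρη⟩ : ∃ ρ > 0, ρ ≤ r / 2 ∧ K * ρ ≤ η := by
    refine ⟨min (r / 2) (η / (K + 1)), by positivity, min_le_left _ _, ?_⟩
    calc K * min (r / 2) (η / (K + 1)) ≤ (K + 1) * (η / (K + 1)) := by
          gcongr
          · linarith
          · exact min_le_right _ _
      _ = η := by field_simp
  let ψ : ContDiffBump (0 : E) := ⟨ρ / 2, ρ, by positivity, by linarith⟩
  let m : Measure E := Measure.addHaar
  have h_ball {x y : E} (hy : y ∈ Metric.ball x (r / 2)) : Metric.ball y ρ ⊆ Metric.ball x r :=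
    Metric.ball_subset_ball' (by linarith [Metric.mem_ball.1 hy])
  refine ⟨convolution (ψ.normed m) f (.lsmul ℝ ℝ) m, ?_, fun x hx => ?_, fun x hx => ?_,
    fun x hx => ?_⟩
  · exact ψ.hasCompactSupport_normed.contDiff_convolution_left _ ψ.contDiff_normed
      hf.locallyIntegrable
  · refine ψ.dist_normed_convolution_le hf.aestronglyMeasurable fun y hy => ?_
    calc dist (f y) (f x) ≤ K * dist y x := (hlip x hx).dist_le_mul y
          (h_ball (Metric.mem_ball_self (half_pos hr)) hy) x (Metric.mem_ball_self hr)
      _ ≤ K * ρ := mul_le_mul_of_nonneg_left (Metric.mem_ball.1 hy).le K.2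
      _ ≤ η := hρη
  · refine norm_fderiv_le_of_lipschitzOn ℝ (Metric.ball_mem_nhds x (half_pos hr)) ?_
    refine lipschitzOnWith_normed_convolution m ψ hf ((hlip x hx).mono ?_)
    exact Metric.ball_subset_ball (by change r / 2 + ρ ≤ r; linarith)
  · filter_upwards [Metric.ball_mem_nhds x (half_pos hr)] with y hy
    have hfy (w : E) (hw : w ∈ Metric.ball y ψ.rOut) : f w = 0 := hx w (h_ball hy hw)
    rw [ψ.normed_convolution_eq_right fun w hw => by
      rw [hfy w hw, hfy y (Metric.mem_ball_self ψ.rOut_pos)], Pi.zero_apply]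
    exact hfy y (Metric.mem_ball_self ψ.rOut_pos)

end Mollification

section SoftThreshold

/-- The map shrinking a real number towards `0` by `η`. It makes a function vanish near its zeros
at a cost of `η` in the sup norm, without increasing its Lipschitz constant. -/
noncomputable def softThreshold (η a : ℝ) : ℝ := max (a - η) 0 + min (a + η) 0

theorem lipschitzWith_softThreshold {η : ℝ} (hη : 0 ≤ η) : LipschitzWith 1 (softThreshold η) := by
  refine LipschitzWith.of_dist_le_mul fun a b => ?_
  simp only [Real.dist_eq, NNReal.coe_one, one_mul, softThreshold]
  grind

theorem dist_softThreshold_le {η : ℝ} (hη : 0 ≤ η) (a : ℝ) : dist (softThreshold η a) a ≤ η := by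
  simp only [Real.dist_eq, softThreshold]
  grind

theorem softThreshold_eq_zero {η a : ℝ} (h : |a| ≤ η) : softThreshold η a = 0 := by
  unfold softThreshold
  grind

end SoftThreshold

section Gradient

variable {H : Type*} [NormedAddCommGroup H] [InnerProductSpace ℝ H] [CompleteSpace H]
  {φ ψ : H → ℝ} {x : H}

theorem continuous_gradient (hφ : ContDiff ℝ 1 φ) : Continuous (gradient φ) :=
  (InnerProductSpace.toDual ℝ H).symm.continuous.comp (hφ.continuous_fderiv one_ne_zero)

theorem gradient_add (hφ : DifferentiableAt ℝ φ x) (hψ : DifferentiableAt ℝ ψ x) :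
    gradient (φ + ψ) x = gradient φ x + gradient ψ x := by
  simp only [gradient, fderiv_add hφ hψ, map_add]

theorem gradient_const_smul (hφ : DifferentiableAt ℝ φ x) (a : ℝ) :
    gradient (a • φ) x = a • gradient φ x := by
  simp [gradient, fderiv_const_smul hφ]

end Gradient

section TestFunctions

variable {n : ℕ} {A Ω Z : Set (EuclideanSpace ℝ (Fin n))} {φ : EuclideanSpace ℝ (Fin n) → ℝ}

/-- The smooth functions with compact support in the complement of `Z`, against which the
divergence condition `NegDivEq Z` is tested. -/
def testFunctions (Z : Set (EuclideanSpace ℝ (Fin n))) :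
    Submodule ℝ (EuclideanSpace ℝ (Fin n) → ℝ) where
  carrier := {φ | ContDiff ℝ ∞ φ ∧ HasCompactSupport φ ∧ tsupport φ ⊆ Zᶜ}
  zero_mem' := ⟨contDiff_const, HasCompactSupport.zero, by simp [tsupport]⟩
  add_mem' := fun ⟨hφ, hφ_comp, hφ_supp⟩ ⟨hψ, hψ_comp, hψ_supp⟩ =>
    ⟨hφ.add hψ, hφ_comp.add hψ_comp, (tsupport_add _ _).trans (union_subset hφ_supp hψ_supp)⟩
  smul_mem' := fun a _ ⟨hφ, hφ_comp, hφ_supp⟩ =>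
    ⟨contDiff_const.smul hφ, hφ_comp.smul_left,
      (closure_mono (Function.support_const_smul_subset a _)).trans hφ_supp⟩

theorem eq_zero_of_mem_testFunctions (hφ : φ ∈ testFunctions Z) {z : EuclideanSpace ℝ (Fin n)}
    (hz : z ∈ Z) : φ z = 0 :=
  image_eq_zero_of_notMem_tsupport fun h => hφ.2.2 h hz

theorem differentiable_of_mem_testFunctions (hφ : φ ∈ testFunctions Z) : Differentiable ℝ φ :=
  hφ.1.differentiable (by simp)

/-- The gradient of test functions, restricted to `A`. -/
noncomputable def gradientₗ (Z A : Set (EuclideanSpace ℝ (Fin n))) :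
    testFunctions Z →ₗ[ℝ] C(A, EuclideanSpace ℝ (Fin n)) where
  toFun φ := ⟨fun x => gradient (φ : EuclideanSpace ℝ (Fin n) → ℝ) x,
    (continuous_gradient (φ.2.1.of_le (by simp))).comp continuous_subtype_val⟩
  map_add' φ ψ := ContinuousMap.ext fun _ =>
    gradient_add (differentiable_of_mem_testFunctions φ.2 _)
      (differentiable_of_mem_testFunctions ψ.2 _)
  map_smul' a φ := ContinuousMap.ext fun _ =>
    gradient_const_smul (differentiable_of_mem_testFunctions φ.2 _) a

/-- The restriction of test functions to `A`. -/
def restrictₗ (Z A : Set (EuclideanSpace ℝ (Fin n))) : testFunctions Z →ₗ[ℝ] C(A, ℝ) where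
  toFun φ := ⟨fun x => (φ : EuclideanSpace ℝ (Fin n) → ℝ) x,
    φ.2.1.continuous.comp continuous_subtype_val⟩
  map_add' _ _ := rfl
  map_smul' _ _ := rfl

theorem exists_testFunction_eventuallyEq (hA : Bornology.IsBounded A) (hφ : ContDiff ℝ ∞ φ)
    (hZ : ∀ z ∈ Z, φ =ᶠ[𝓝 z] 0) : ∃ ψ ∈ testFunctions Z, ∀ x ∈ A, ψ =ᶠ[𝓝 x] φ := by
  obtain ⟨R, hR, hAR⟩ := hA.subset_ball_lt 0 0
  let χ : ContDiffBump (0 : EuclideanSpace ℝ (Fin n)) := ⟨R, R + 1, hR, lt_add_one R⟩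
  refine ⟨χ * φ, ⟨χ.contDiff.mul hφ, χ.hasCompactSupport.mul_right, fun z h_supp hz => ?_⟩,
    fun x hx => ?_⟩
  · refine notMem_tsupport_iff_eventuallyEq.2 ?_ h_supp
    filter_upwards [hZ z hz] with y hy
    simp [hy]
  · filter_upwards [Metric.isOpen_ball.mem_nhds (hAR hx)] with y hy
    simp [χ.one_of_mem_closedBall (Metric.ball_subset_closedBall hy)]

theorem exists_testFunction_approx_of_lipschitzOnWith {f : EuclideanSpace ℝ (Fin n) → ℝ}
    (hf : Continuous f) (hA : Bornology.IsBounded A) {r : ℝ} (hr : 0 < r) {K : ℝ≥0}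
    (hf_lip : ∀ x ∈ A, LipschitzOnWith K f (Metric.ball x r))
    (hfZ : ∀ z ∈ Z, ∀ y ∈ Metric.ball z r, f y = 0) {ε : ℝ} (hε : 0 < ε) :
    ∃ φ ∈ testFunctions Z, (∀ x ∈ A, ‖gradient φ x‖ ≤ K) ∧ ∀ x ∈ A, dist (φ x) (f x) ≤ ε := by
  obtain ⟨h, h_smooth, h_dist, h_fderiv, h_zero⟩ := exists_contDiff_approx hf hr hf_lip hε
  obtain ⟨φ, hφ, hφh⟩ :=
    exists_testFunction_eventuallyEq hA h_smooth fun z hz => h_zero z (hfZ z hz)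
  refine ⟨φ, hφ, fun x hx => ?_, fun x hx => ?_⟩
  · rw [gradient, LinearIsometryEquiv.norm_map, (hφh x hx).fderiv_eq]
    exact h_fderiv x hx
  · rw [(hφh x hx).eq_of_nhds]
    exact h_dist x hx

theorem exists_dist_lt_of_isCompact {X Y : Type*} [PseudoMetricSpace X] [PseudoMetricSpace Y]
    {A : Set X} {g : X → Y} (hA : IsCompact A) (hg : Continuous g) {η : ℝ} (hη : 0 < η) :
    ∃ δ > 0, ∀ x ∈ A, ∀ y, dist y x < δ → dist (g y) (g x) < η := by
  obtain ⟨δ, hδ, h⟩ := Metric.mem_uniformity_dist.1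
    (hA.uniformContinuousAt_of_continuousAt g (fun _ _ => hg.continuousAt)
      (Metric.dist_mem_uniformity hη))
  refine ⟨δ, hδ, fun x hx y hxy => ?_⟩
  rw [dist_comm] at hxy ⊢
  exact h hxy hx

theorem lipschitzOnWith_of_segment_subset {E : Type*} [NormedAddCommGroup E] [NormedSpace ℝ E]
    {A B : Set E} {g : E → ℝ} (hg : ∀ x y, segment ℝ x y ⊆ A → dist (g x) (g y) ≤ dist x y)
    (hB : Convex ℝ B) (hBA : B ⊆ A) : LipschitzOnWith 1 g B :=
  LipschitzOnWith.of_dist_le_mul fun x hx y hy => by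
    simpa using hg x y ((hB.segment_subset hx hy).trans hBA)

theorem exists_testFunction_approx (hΩ : IsOpen Ω) (hlip : HasLipschitzBoundary Ω)
    (hcomp : IsCompact (closure Ω)) (hZ : Z ⊆ closure Ω) {g : EuclideanSpace ℝ (Fin n) → ℝ}
    (hg : Continuous g)
    (hg_seg : ∀ x y, segment ℝ x y ⊆ closure Ω → dist (g x) (g y) ≤ dist x y)
    (hgZ : ∀ z ∈ Z, g z = 0) {K : ℝ≥0} (hK : 1 < K) {ε : ℝ} (hε : 0 < ε) :
    ∃ φ ∈ testFunctions Z, (∀ x ∈ closure Ω, ‖gradient φ x‖ ≤ K) ∧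
      ∀ x ∈ closure Ω, dist (φ x) (g x) ≤ ε := by
  have hη : 0 < ε / 3 := by positivity
  obtain ⟨δ, hδ, hgδ⟩ := exists_dist_lt_of_isCompact hcomp hg hη
  obtain ⟨Φ, hΦ⟩ := exists_isInwardPush hΩ hlip hcomp hK (half_pos hδ)
  obtain ⟨ρ, hρδ, r, hr, hΦ_ball⟩ := hΦ.exists_mapsTo_ball hΩ hcomp (half_pos hδ)
  let f := softThreshold (ε / 3) ∘ g ∘ Φ
  have hf : Continuous f :=
    (lipschitzWith_softThreshold hη.le).continuous.comp (hg.comp hΦ.lipschitz.continuous)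
  have hf_lip : ∀ x ∈ closure Ω, LipschitzOnWith K f (Metric.ball x r) := fun x hx => by
    have hg_ball : LipschitzOnWith 1 g (Metric.ball (Φ x) ρ) :=
      lipschitzOnWith_of_segment_subset hg_seg (convex_ball _ _)
        ((hΦ_ball x hx).1.trans subset_closure)
    simpa using (lipschitzWith_softThreshold hη.le).comp_lipschitzOnWith
      (hg_ball.comp hΦ.lipschitz.lipschitzOnWith (hΦ_ball x hx).2)
  have hfZ : ∀ z ∈ Z, ∀ y ∈ Metric.ball z r, f y = 0 := fun z hz y hy => by
    have h_push : dist (Φ y) (Φ z) < ρ := (hΦ_ball z (hZ hz)).2 hy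
    have h_close : dist (Φ y) z < δ := by
      linarith [dist_triangle (Φ y) (Φ z) z, hΦ.dist_le z]
    have h_small := hgδ z (hZ hz) (Φ y) h_close
    rw [hgZ z hz, Real.dist_eq, sub_zero] at h_small
    exact softThreshold_eq_zero h_small.le
  obtain ⟨φ, hφ, hφ_grad, hφf⟩ :=
    exists_testFunction_approx_of_lipschitzOnWith hf hcomp.isBounded hr hf_lip hfZ hη
  refine ⟨φ, hφ, hφ_grad, fun x hx => ?_⟩
  have h_push := hgδ x hx (Φ x) (by linarith [hΦ.dist_le x])
  have h_threshold : dist (f x) (g (Φ x)) ≤ ε / 3 := dist_softThreshold_le hη.le _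
  linarith [hφf x hx, dist_triangle4 (φ x) (f x) (g (Φ x)) (g x)]

end TestFunctions

section Duality

variable {n : ℕ} {Ω Z : Set (EuclideanSpace ℝ (Fin n))} {φ : EuclideanSpace ℝ (Fin n) → ℝ}
  {μ ν : Measure (closure Ω)}

theorem NegDivEq.integral_sub_le {Λ : VectorMeasure (closure Ω) (EuclideanSpace ℝ (Fin n))}
    (h : NegDivEq Z Λ μ ν) (hΛ : Λ.variation univ < ⊤) (hφ : φ ∈ testFunctions Z) {K : ℝ≥0}
    (hgrad : ∀ x ∈ closure Ω, ‖gradient φ x‖ ≤ K) :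
    (∫ x : closure Ω, φ x ∂μ) - ∫ x : closure Ω, φ x ∂ν ≤ K * (Λ.variation univ).toReal := by
  have : IsFiniteMeasure Λ.variation := ⟨hΛ⟩
  rw [← h φ hφ.1 hφ.2.1 hφ.2.2]
  refine (Real.le_norm_self _).trans ((VectorMeasure.norm_integral_le_of_norm_le_const
    (ae_of_all _ fun x : closure Ω => hgrad x x.2)).trans ?_)
  exact mul_le_mul_of_nonneg_right (mul_le_of_le_one_right K.2 (norm_innerSL_le ℝ))
    ENNReal.toReal_nonneg

theorem edist_le_mul_freeZoneCost_of_mem_testFunctions (hφ : φ ∈ testFunctions Z) {K : ℝ≥0}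
    (hgrad : ∀ x ∈ closure Ω, ‖gradient φ x‖ < K) (hK : K ≠ 0) {x y : EuclideanSpace ℝ (Fin n)} :
    edist (φ x) (φ y) ≤ K * freeZoneCost Ω Z x y :=
  edist_le_mul_freeZoneCost hK
    (fun x hx => exists_lipschitzOnWith_of_norm_gradient_lt
      (hφ.1.contDiffAt.of_le (by simp)) (hgrad x hx))
    fun _ hz => eq_zero_of_mem_testFunctions hφ hz

variable [CompactSpace (closure Ω)] [IsProbabilityMeasure μ] [IsProbabilityMeasure ν]

theorem transportCost_freeZoneCost_ne_top (hΩ : IsOpen Ω) (hconn : IsPreconnected Ω)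
    (hlip : HasLipschitzBoundary Ω) :
    transportCost (fun x y : closure Ω => freeZoneCost Ω Z x y) μ ν ≠ ⊤ := by
  have : Nonempty (closure Ω) := nonempty_of_isProbabilityMeasure μ
  obtain ⟨q, -, hq⟩ := isCompact_univ.exists_isMaxOn univ_nonempty
    (continuous_freeZoneCost (Z := Z) hΩ hlip).continuousOn
  have hq_fin := (freeZoneCost_lt_top (Z := Z) hΩ hconn hlip q.1.2 q.2.2).ne
  refine ((transportCost_le_lintegral (γ := μ.prod ν) (by simp) (by simp)).trans_lt
    (IsFiniteMeasure.lintegral_lt_top_of_bounded_to_ennreal _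
      ⟨(freeZoneCost Ω Z q.1 q.2).toNNReal, fun p => ?_⟩)).ne
  rw [ENNReal.coe_toNNReal hq_fin]
  exact hq (mem_univ p)

theorem integral_sub_le_transportCost_mul_norm_gradientₗ (hΩ : IsOpen Ω)
    (hconn : IsPreconnected Ω) (hlip : HasLipschitzBoundary Ω) (φ : testFunctions Z) :
    (integralₗ μ - integralₗ ν) (restrictₗ Z (closure Ω) φ)
      ≤ (transportCost (fun x y : closure Ω => freeZoneCost Ω Z x y) μ ν).toReal
        * ‖gradientₗ Z (closure Ω) φ‖ := by
  set T := transportCost (fun x y : closure Ω => freeZoneCost Ω Z x y) μ ν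
  set u := restrictₗ Z (closure Ω) φ
  have hT_fin : T ≠ ⊤ := transportCost_freeZoneCost_ne_top hΩ hconn hlip
  have h_bound (K : ℝ≥0) (hK : ‖gradientₗ Z (closure Ω) φ‖₊ < K) :
      (integralₗ μ - integralₗ ν) u ≤ T.toReal * K := by
    have h_edist (x y : closure Ω) : edist (u x) (u y) ≤ K * freeZoneCost Ω Z x y :=
      edist_le_mul_freeZoneCost_of_mem_testFunctions φ.2
        (fun x hx => ((gradientₗ Z (closure Ω) φ).norm_coe_le_norm ⟨x, hx⟩).trans_lt hK)
        (pos_of_gt hK).ne'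
    have h_weak := ofReal_integral_sub_le_mul_transportCost u.continuous.measurable
      (integrable_of_continuous u.continuous) (integrable_of_continuous u.continuous)
      (pos_of_gt hK).ne' h_edist (μ := μ) (ν := ν)
    rw [ENNReal.ofReal_le_iff_le_toReal (ENNReal.mul_ne_top ENNReal.coe_ne_top hT_fin),
      ENNReal.toReal_mul, ENNReal.coe_toReal, mul_comm] at h_weak
    exact h_weak
  have h_lim : ContinuousWithinAt (fun K : ℝ≥0 => T.toReal * K)
      (Ioi ‖gradientₗ Z (closure Ω) φ‖₊) ‖gradientₗ Z (closure Ω) φ‖₊ :=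
    (continuous_const.mul NNReal.continuous_coe).continuousWithinAt
  exact ge_of_tendsto h_lim (Filter.eventually_of_mem self_mem_nhdsWithin h_bound)

theorem exists_negDivEq_variation_le (hΩ : IsOpen Ω) (hconn : IsPreconnected Ω)
    (hlip : HasLipschitzBoundary Ω) :
    ∃ Λ : VectorMeasure (closure Ω) (EuclideanSpace ℝ (Fin n)), NegDivEq Z Λ μ ν ∧
      Λ.variation univ ≤ transportCost (fun x y : closure Ω => freeZoneCost Ω Z x y) μ ν := by
  have : Nonempty (closure Ω) := nonempty_of_isProbabilityMeasure μ
  obtain ⟨Λ, hΛ, hdiv⟩ := exists_vectorMeasure_of_dual_le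
    (D := gradientₗ Z (closure Ω)) (L := (integralₗ μ - integralₗ ν) ∘ₗ restrictₗ Z (closure Ω))
    (T := (transportCost (fun x y : closure Ω => freeZoneCost Ω Z x y) μ ν).toNNReal)
    (integral_sub_le_transportCost_mul_norm_gradientₗ hΩ hconn hlip)
  rw [ENNReal.coe_toNNReal (transportCost_freeZoneCost_ne_top hΩ hconn hlip)] at hΛ
  exact ⟨Λ, fun φ hφ hφ_comp hφ_supp => hdiv ⟨φ, hφ, hφ_comp, hφ_supp⟩, hΛ⟩

end Duality

section Potentials

theorem integral_sub_le_of_dist_le {X : Type*} [TopologicalSpace X] [CompactSpace X]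
    [MeasurableSpace X] [OpensMeasurableSpace X] {μ ν : Measure X} [IsProbabilityMeasure μ]
    [IsProbabilityMeasure ν] {u v : X → ℝ} (hu : Continuous u) (hv : Continuous v) {a ε : ℝ}
    (h : ∀ x, dist (v x) (u x - a) ≤ ε) :
    ∫ x, u x ∂μ - ∫ x, u x ∂ν ≤ ∫ x, v x ∂μ - ∫ x, v x ∂ν + 2 * ε := by
  have h_upper : ∫ x, (u x - v x) ∂μ ≤ ∫ _, (a + ε) ∂μ :=
    integral_mono (integrable_of_continuous (hu.sub hv)) (integrable_const _) fun x => by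
      linarith [(abs_le.1 (h x)).1]
  have h_lower : ∫ _, (a - ε) ∂ν ≤ ∫ x, (u x - v x) ∂ν :=
    integral_mono (integrable_const _) (integrable_of_continuous (hu.sub hv)) fun x => by
      linarith [(abs_le.1 (h x)).2]
  rw [integral_sub (integrable_of_continuous hu) (integrable_of_continuous hv)] at h_upper h_lower
  simp only [integral_const, probReal_univ, one_smul] at h_upper h_lower
  linarith

variable {n : ℕ} {Ω Z : Set (EuclideanSpace ℝ (Fin n))} {u : C(closure Ω, ℝ)}

theorem exists_forall_mem_eq_of_sub_le_freeZoneCost (hZ : Z ⊆ closure Ω)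
    (hu : ∀ x y : closure Ω, u x - u y ≤ (freeZoneCost Ω Z x y).toReal) :
    ∃ a, ∀ x : closure Ω, (x : EuclideanSpace ℝ (Fin n)) ∈ Z → u x = a := by
  have h_eq (x y : closure Ω) (hx : (x : EuclideanSpace ℝ (Fin n)) ∈ Z)
      (hy : (y : EuclideanSpace ℝ (Fin n)) ∈ Z) : u x ≤ u y := by
    simpa [freeZoneCost_eq_zero hZ hx hy] using hu x y
  rcases Z.eq_empty_or_nonempty with rfl | ⟨z, hz⟩
  · exact ⟨0, fun x hx => absurd hx (notMem_empty _)⟩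
  · exact ⟨u ⟨z, hZ hz⟩, fun x hx => le_antisymm (h_eq _ _ hx hz) (h_eq _ _ hz hx)⟩

theorem dist_le_of_sub_le_freeZoneCost
    (hu : ∀ x y : closure Ω, u x - u y ≤ (freeZoneCost Ω Z x y).toReal) {x y : closure Ω}
    (hxy : segment ℝ (x : EuclideanSpace ℝ (Fin n)) y ⊆ closure Ω) :
    dist (u x) (u y) ≤ dist x y := by
  have h_cost : (freeZoneCost Ω Z x y).toReal ≤ dist x y := by
    refine ENNReal.toReal_le_of_le_ofReal dist_nonneg ?_
    rw [← edist_dist]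
    exact freeZoneCost_le_geodesicDist.trans (geodesicDist_le_edist hxy)
  rw [Real.dist_eq, abs_sub_le_iff]
  exact ⟨(hu x y).trans h_cost, (hu y x).trans (by rwa [freeZoneCost_comm])⟩

theorem exists_testFunction_approx_of_sub_le_freeZoneCost (hΩ : IsOpen Ω)
    (hlip : HasLipschitzBoundary Ω) (hcomp : IsCompact (closure Ω)) (hZ : Z ⊆ closure Ω)
    (hu : ∀ x y : closure Ω, u x - u y ≤ (freeZoneCost Ω Z x y).toReal) {K : ℝ≥0} (hK : 1 < K)
    {ε : ℝ} (hε : 0 < ε) :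
    ∃ φ ∈ testFunctions Z, ∃ a, (∀ x ∈ closure Ω, ‖gradient φ x‖ ≤ K) ∧
      ∀ x : closure Ω, dist (φ x) (u x - a) ≤ ε := by
  obtain ⟨a, ha⟩ := exists_forall_mem_eq_of_sub_le_freeZoneCost hZ hu
  obtain ⟨g, hg⟩ := ContinuousMap.exists_restrict_eq isClosed_closure (u - .const _ a)
  have hgu (x : closure Ω) : g x = u x - a := congrArg (fun f : C(closure Ω, ℝ) => f x) hg
  have hg_seg (x y : EuclideanSpace ℝ (Fin n)) (hxy : segment ℝ x y ⊆ closure Ω) :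
      dist (g x) (g y) ≤ dist x y := by
    let x' : closure Ω := ⟨x, hxy (left_mem_segment ℝ x y)⟩
    let y' : closure Ω := ⟨y, hxy (right_mem_segment ℝ x y)⟩
    rw [hgu x', hgu y', dist_sub_right]
    exact dist_le_of_sub_le_freeZoneCost hu (x := x') (y := y') hxy
  have hgZ (z : EuclideanSpace ℝ (Fin n)) (hz : z ∈ Z) : g z = 0 := by
    rw [hgu ⟨z, hZ hz⟩, ha _ hz, sub_self]
  obtain ⟨φ, hφ, hgrad, hφg⟩ :=
    exists_testFunction_approx hΩ hlip hcomp hZ g.continuous hg_seg hgZ hK hε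
  exact ⟨φ, hφ, a, hgrad, fun x => hgu x ▸ hφg x x.2⟩

theorem NegDivEq.integral_sub_le_of_sub_le_freeZoneCost {μ ν : Measure (closure Ω)}
    [IsProbabilityMeasure μ] [IsProbabilityMeasure ν]
    {Λ : VectorMeasure (closure Ω) (EuclideanSpace ℝ (Fin n))} (h : NegDivEq Z Λ μ ν)
    (hΛ : Λ.variation univ < ⊤) (hΩ : IsOpen Ω) (hlip : HasLipschitzBoundary Ω)
    (hcomp : IsCompact (closure Ω)) (hZ : Z ⊆ closure Ω)
    (hu : ∀ x y : closure Ω, u x - u y ≤ (freeZoneCost Ω Z x y).toReal) :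
    ∫ x, u x ∂μ - ∫ x, u x ∂ν ≤ (Λ.variation univ).toReal := by
  have : CompactSpace (closure Ω) := isCompact_iff_compactSpace.1 hcomp
  have h_approx (ε : ℝ≥0) (hε : 0 < ε) :
      ∫ x, u x ∂μ - ∫ x, u x ∂ν ≤ (1 + ε : ℝ≥0) * (Λ.variation univ).toReal + 2 * ε := by
    obtain ⟨φ, hφ, a, hgrad, hφu⟩ := exists_testFunction_approx_of_sub_le_freeZoneCost hΩ hlip
      hcomp hZ hu (lt_add_of_pos_right 1 hε) (NNReal.coe_pos.2 hε)
    have hφ_cont : Continuous fun x : closure Ω => φ x :=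
      hφ.1.continuous.comp continuous_subtype_val
    linarith [integral_sub_le_of_dist_le u.continuous hφ_cont hφu (μ := μ) (ν := ν),
      h.integral_sub_le hΛ hφ hgrad]
  have h_lim : Filter.Tendsto
      (fun ε : ℝ≥0 => (1 + ε : ℝ≥0) * (Λ.variation univ).toReal + 2 * (ε : ℝ))
      (𝓝[>] 0) (𝓝 (Λ.variation univ).toReal) :=
    tendsto_nhdsWithin_of_tendsto_nhds (Continuous.tendsto' (by fun_prop) _ _ (by simp))
  exact ge_of_tendsto h_lim (Filter.eventually_of_mem self_mem_nhdsWithin h_approx)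

theorem NegDivEq.transportCost_le {μ ν : Measure (closure Ω)}
    [IsProbabilityMeasure μ] [IsProbabilityMeasure ν]
    {Λ : VectorMeasure (closure Ω) (EuclideanSpace ℝ (Fin n))} (h : NegDivEq Z Λ μ ν)
    (hΛ : Λ.variation univ < ⊤) (hΩ : IsOpen Ω) (hconn : IsPreconnected Ω)
    (hlip : HasLipschitzBoundary Ω) (hcomp : IsCompact (closure Ω)) (hZ : Z ⊆ closure Ω) :
    transportCost (fun x y : closure Ω => freeZoneCost Ω Z x y) μ ν ≤ Λ.variation univ := by
  have : CompactSpace (closure Ω) := isCompact_iff_compactSpace.1 hcomp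
  rw [← ENNReal.ofReal_toReal hΛ.ne]
  exact transportCost_le_of_forall_sub_le (c := fun x y : closure Ω => freeZoneCost Ω Z x y)
    (fun x y => (freeZoneCost_lt_top hΩ hconn hlip x.2 y.2).ne)
    (continuous_freeZoneCost hΩ hlip) (fun x => freeZoneCost_self x.2)
    (fun _ _ _ => freeZoneCost_triangle)
    fun _ hu => h.integral_sub_le_of_sub_le_freeZoneCost hΛ hΩ hlip hcomp hZ hu

theorem isLeast_flowMasses_freeZoneCost (hΩ : IsOpen Ω) (hbdd : Bornology.IsBounded Ω)
    (hconn : IsPreconnected Ω) (hlip : HasLipschitzBoundary Ω) (hZ : Z ⊆ closure Ω)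
    (μ ν : Measure (closure Ω)) [IsProbabilityMeasure μ] [IsProbabilityMeasure ν] :
    IsLeast (flowMasses Z μ ν)
      (transportCost (fun x y : closure Ω => freeZoneCost Ω Z x y) μ ν) := by
  have hcomp : IsCompact (closure Ω) := hbdd.isCompact_closure
  have : CompactSpace (closure Ω) := isCompact_iff_compactSpace.1 hcomp
  constructor
  · obtain ⟨Λ, hdiv, hΛ⟩ := exists_negDivEq_variation_le (μ := μ) (ν := ν) (Z := Z) hΩ hconn hlip
    have hΛ_fin := hΛ.trans_lt (transportCost_freeZoneCost_ne_top hΩ hconn hlip).lt_top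
    exact ⟨Λ, hΛ_fin, hdiv,
      le_antisymm hΛ (hdiv.transportCost_le hΛ_fin hΩ hconn hlip hcomp hZ)⟩
  · rintro _ ⟨Λ, hΛ, hdiv, rfl⟩
    exact hdiv.transportCost_le hΛ hΩ hconn hlip hcomp hZ

theorem curveCost_eq_freeZoneCost (hΩ : IsOpen Ω) (hlip : HasLipschitzBoundary Ω)
    (hZ : Z ⊆ closure Ω) (h0 : ∀ a ∈ Z, ∀ b ∈ Z, curveCost Ω Z a b = 0)
    {x y : EuclideanSpace ℝ (Fin n)} :
    curveCost Ω Z x y = freeZoneCost Ω Z x y := by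
  refine le_antisymm (curveCost_le_freeZoneCost h0) ?_
  calc freeZoneCost Ω Z x y
      ≤ freeZoneCost Ω (closure Z) x y := freeZoneCost_le_freeZoneCost_closure hΩ hlip hZ
    _ ≤ curveCost Ω (closure Z) x y := freeZoneCost_le_curveCost isClosed_closure
    _ ≤ curveCost Ω Z x y := curveCost_anti_right subset_closure

end Potentials

end GeodesicTransport

theorem mainTheorem9_general {n : ℕ} {Ω Z : Set (EuclideanSpace ℝ (Fin n))}
    (hΩ_open : IsOpen Ω) (hΩ_bdd : Bornology.IsBounded Ω) (hΩ_conn : IsPreconnected Ω)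
    (hΩ_lip : GeodesicTransport.HasLipschitzBoundary Ω) (hZΩ : Z ⊆ closure Ω)
    (μ ν : Measure (closure Ω)) [IsProbabilityMeasure μ] [IsProbabilityMeasure ν] :
    IsLeast (GeodesicTransport.flowMasses Z μ ν)
      (GeodesicTransport.transportCost
        (fun x y : closure Ω => GeodesicTransport.freeZoneCost Ω Z x y) μ ν) ∧
    ((∀ a ∈ Z, ∀ b ∈ Z, GeodesicTransport.curveCost Ω Z a b = 0) →
      IsLeast (GeodesicTransport.flowMasses Z μ ν)
        (GeodesicTransport.transportCost
          (fun x y : closure Ω => GeodesicTransport.curveCost Ω Z x y) μ ν)) := by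
  have h := GeodesicTransport.isLeast_flowMasses_freeZoneCost hΩ_open hΩ_bdd hΩ_conn hΩ_lip hZΩ μ ν
  refine ⟨h, fun h0 => ?_⟩
  simpa only [GeodesicTransport.curveCost_eq_freeZoneCost hΩ_open hΩ_lip hZΩ h0] using h

theorem mainTheorem9 {n : ℕ} (Ω Z : Set (EuclideanSpace ℝ (Fin n)))
    (hΩ_open : IsOpen Ω) (hΩ_bdd : Bornology.IsBounded Ω) (hΩ_conn : IsConnected Ω)
    (hΩ_lip : GeodesicTransport.HasLipschitzBoundary Ω)
    (hZ : IsCompact Z) (hZΩ : Z ⊆ closure Ω)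
    (μ ν : Measure (closure Ω)) [IsProbabilityMeasure μ] [IsProbabilityMeasure ν] :
    IsLeast (GeodesicTransport.flowMasses Z μ ν)
      (GeodesicTransport.transportCost
        (fun x y : closure Ω => GeodesicTransport.freeZoneCost Ω Z x y) μ ν) ∧
    ((∀ a ∈ Z, ∀ b ∈ Z, GeodesicTransport.curveCost Ω Z a b = 0) →
      IsLeast (GeodesicTransport.flowMasses Z μ ν)
        (GeodesicTransport.transportCost
          (fun x y : closure Ω => GeodesicTransport.curveCost Ω Z x y) μ ν)) :=
  mainTheorem9_general hΩ_open hΩ_bdd hΩ_conn.isPreconnected hΩ_lip hZΩ μ ν
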